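/- Let $\mathfrak g$ be a finite-dimensional complex semisimple Lie algebra with Cartan subalgebra $\mathfrak h$, a base of simple roots $\alpha_1,\dots,\alpha_r$, simple coroots $h_1,\dots,h_r\in\mathfrak h$, weight lattice $P\subset\mathfrak h^*$, and let $\mathfrak n_+$ be the sum of the positive root spaces. Let $A$ be a commutative $\mathbb C$-algebra with unit (for instance the algebra of functions on an affine variety $M$), and let $M$ denote the set of its points, i.e. of ideals of codimension one in $A$, equivalently of unital algebra homomorphisms $A\to\mathbb C$; for $z\in M$ and $p\in A$ write $p(z)\in\mathbb C$ for the value of $p$ at $z$. Consider $\mathfrak g\otimes A$ as a complex Lie algebra with bracket $[x\otimes p,y\otimes q]=[x,y]\otimes pq$. A $\mathfrak g\otimes A$-module $V$ is called integrable if there is a finite set $D\subset P$ with $V=\bigoplus_{\mu\in D}V^\mu$, where every $h\otimes 1$ with $h\in\mathfrak h$ acts on $V^\mu$ by the scalar $\mu(h)$. For a dominant integral weight $\lambda\in\mathfrak h^*$ with $\lambda_i=\lambda(h_i)$, a $\lambda$-multiset $\{\mathcal Z\}_\lambda$ consists, for each $i=1,\dots,r$, of a multiset $\{\mathcal Z^{(i)}_j\}_{j=1,\dots,\lambda_i}$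 of points of $M$. The local Weyl module $W_M(\{\mathcal Z\}_\lambda)$ is the maximal integrable $\mathfrak g\otimes A$-module generated by a vector $v$ such that $$(\mathfrak n_+\otimes p)\,v=0,\qquad (h_i\otimes p)\,v=\sum_{j=1}^{\lambda_i}p\bigl(\mathcal Z^{(i)}_j\bigr)\,v\qquad(i=1,\dots,r,\ p\in A);$$ maximal means that any other module with a generator having these properties is a quotient of it, with generator mapped to generator. Theorem. Let $\{\mathcal Z\}_\lambda$ be a $\lambda$-multiset and $\{\mathcal Z'\}_{\lambda'}$ a $\lambda'$-multiset such that $\mathcal Z^{(i)}_j\ne(\mathcal Z')^{(i')}_{j'}$ for all $i,j,i',j'$. Let $\{\mathcal Z\cup\mathcal Z'\}_{\lambda+\lambda'}$ be the $(\lambda+\lambda')$-multiset whose $i$-th component is the union, with multiplicities added, of the $i$-th components of the two. Then the local Weyl modules $W_M(\{\mathcal Z\}_\lambda)$, $W_M(\{\mathcal Z'\}_{\lambda'})$ and $W_M(\{\mathcal Z\cup\mathcal Z'\}_{\lambda+\lambda'})$ exist, and there is an isomorphism of $\mathfrak g\otimes A$-modules $$W_M(\{\mathcal Z\cup\mathcal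 Z'\}_{\lambda+\lambda'})\;\cong\;W_M(\{\mathcal Z\}_\lambda)\otimes_{\mathbb C}W_M(\{\mathcal Z'\}_{\lambda'}).$$ -/

import Mathlib

open scoped TensorProduct

universe w

noncomputable section

namespace LocalWeyl

/-! ### Cyclic modules `U(K) / J` -/

section Enveloping

variable (K : Type*) [LieRing K] [LieAlgebra ℂ K]

/-- Left ideals of the universal enveloping algebra `U(K)`. -/
abbrev LeftIdeal : Type _ :=
  Submodule (UniversalEnvelopingAlgebra ℂ K) (UniversalEnvelopingAlgebra ℂ K)

variable {K}

/-- The cyclic module `U(K) / J`, regarded below as a module over the Lie algebra `K`. -/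
def CyclicModule (J : LeftIdeal K) : Type _ := UniversalEnvelopingAlgebra ℂ K ⧸ J

namespace CyclicModule

variable (J : LeftIdeal K)

instance : AddCommGroup (CyclicModule J) :=
  inferInstanceAs (AddCommGroup (UniversalEnvelopingAlgebra ℂ K ⧸ J))

instance : Module ℂ (CyclicModule J) :=
  inferInstanceAs (Module ℂ (UniversalEnvelopingAlgebra ℂ K ⧸ J))

instance : Module (UniversalEnvelopingAlgebra ℂ K) (CyclicModule J) :=
  inferInstanceAs (Module (UniversalEnvelopingAlgebra ℂ K)
    (UniversalEnvelopingAlgebra ℂ K ⧸ J))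

instance : IsScalarTower ℂ (UniversalEnvelopingAlgebra ℂ K) (CyclicModule J) :=
  inferInstanceAs (IsScalarTower ℂ (UniversalEnvelopingAlgebra ℂ K)
    (UniversalEnvelopingAlgebra ℂ K ⧸ J))

/-- The class of `1`, the generator of `U(K) / J`. -/
def gen : CyclicModule J :=
  Submodule.Quotient.mk (p := J) (1 : UniversalEnvelopingAlgebra ℂ K)

section

attribute [local instance 100] LieRing.ofAssociativeRing

/-- `x : K` acts on `U(K) / J` as left multiplication by its image in `U(K)`. -/
instance : LieRingModule K (CyclicModule J) where
  bracket x m := UniversalEnvelopingAlgebra.ι ℂ x • m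
  add_lie x y m := by
    rw [map_add, add_smul]
  lie_add x m n := smul_add _ m n
  leibniz_lie x y m := by
    change UniversalEnvelopingAlgebra.ι ℂ x • UniversalEnvelopingAlgebra.ι ℂ y • m =
      UniversalEnvelopingAlgebra.ι ℂ ⁅x, y⁆ • m +
        UniversalEnvelopingAlgebra.ι ℂ y • UniversalEnvelopingAlgebra.ι ℂ x • m
    rw [LieHom.map_lie, LieRing.of_associative_ring_bracket, sub_smul, mul_smul, mul_smul,
      sub_add_cancel]

theorem lie_def (x : K) (m : CyclicModule J) :
    ⁅x, m⁆ = UniversalEnvelopingAlgebra.ι ℂ x • m := rfl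

instance : LieModule ℂ K (CyclicModule J) where
  smul_lie t x m := by rw [lie_def, lie_def, map_smul, smul_assoc]
  lie_smul t x m := by rw [lie_def, lie_def, smul_algebra_smul_comm]

end

end CyclicModule

end Enveloping

/-! ### The semisimple Lie algebra `𝔤`, written `L`, with Cartan subalgebra `H` and base `b` -/

section Weyl

variable {L : Type*} [LieRing L] [LieAlgebra ℂ L] [FiniteDimensional ℂ L]
  [LieAlgebra.IsSemisimple ℂ L]
  {H : LieSubalgebra ℂ L} [H.IsCartanSubalgebra]

/-- The weight lattice `P ⊆ H*`: the functionals taking integral values on all coroots. -/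
def IsIntegralWeight (μ : Module.Dual ℂ H) : Prop :=
  ∀ α : H.root, ∃ n : ℤ, μ ((LieAlgebra.IsKilling.rootSystem H).coroot α) = n

/-- `𝔫₊`, the sum of the root spaces of the roots that are positive with respect to the base. -/
def nPlus (b : (LieAlgebra.IsKilling.rootSystem H).Base) : Submodule ℂ L :=
  ⨆ (α : H.root) (_ : b.IsPos α), (LieAlgebra.rootSpace H (α : LieModule.Weight ℂ H L)).toSubmodule

/-- The `i`-th simple coroot, that is the Chevalley generator `h i`. -/
def simpleCoroot (b : (LieAlgebra.IsKilling.rootSystem H).Base) (i : b.support) : H :=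
  (LieAlgebra.IsKilling.rootSystem H).coroot i

section Modules

variable (H) (A : Type*) [CommRing A] [Algebra ℂ A]
  (V : Type*) [AddCommGroup V] [Module ℂ V] [LieRingModule (A ⊗[ℂ] L) V]
  [LieModule ℂ (A ⊗[ℂ] L) V]

/-- The weight space `V^μ` of a `𝔤 ⊗ A`-module `V` with respect to `𝔤 ⊗ 1`. The Lie algebra
`𝔤 ⊗ A` is written with the factors in the order `A ⊗[ℂ] L`. -/
def weightSpace (μ : Module.Dual ℂ H) : Submodule ℂ V where
  carrier := {v | ∀ h : H, ⁅(1 : A) ⊗ₜ[ℂ] (h : L), v⁆ = μ h • v}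
  add_mem' {v w} hv hw h := by rw [lie_add, hv h, hw h, smul_add]
  zero_mem' h := by rw [lie_zero, smul_zero]
  smul_mem' c v hv h := by rw [lie_smul, hv h, smul_comm]

/-- Integrability over `𝔤 ⊗ 1`: there is a finite set `D` of integral weights such that `V` is
the direct sum of the weight spaces `V^μ`, `μ ∈ D`. (Weight spaces of distinct weights are always
independent, so directness of the sum need not be required.) -/
def IsIntegrable : Prop :=
  ∃ D : Finset (Module.Dual ℂ H), (∀ μ ∈ D, IsIntegralWeight μ) ∧
    ⨆ μ ∈ D, weightSpace H A V μ = ⊤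

end Modules

/-- A `lam`-multiset of points of `M = Spec A`: for every simple root `i` a multiset of
`lam (h i)` points. A point of `M`, that is an ideal of codimension one in `A`, is given by the
corresponding algebra homomorphism `A → ℂ`, evaluation at the point. Such a multiset exists only
if every `lam (h i)` is a nonnegative integer, that is if `lam` is dominant integral. -/
structure LambdaMultiset (b : (LieAlgebra.IsKilling.rootSystem H).Base)
    (A : Type*) [CommRing A] [Algebra ℂ A] (lam : Module.Dual ℂ H) where
  points : b.support → Multiset (A →ₐ[ℂ] ℂ)
  card_points : ∀ i, (Multiset.card (points i) : ℂ) = lam (simpleCoroot b i)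

variable {b : (LieAlgebra.IsKilling.rootSystem H).Base} {A : Type*} [CommRing A] [Algebra ℂ A]
  {lam : Module.Dual ℂ H}

/-- The union of two multisets, with multiplicities added. -/
def LambdaMultiset.union {lam' : Module.Dual ℂ H} (Z : LambdaMultiset b A lam)
    (Z' : LambdaMultiset b A lam') : LambdaMultiset b A (lam + lam') where
  points i := Z.points i + Z'.points i
  card_points i := by
    rw [Multiset.card_add, Nat.cast_add, Z.card_points, Z'.card_points, LinearMap.add_apply]

/-- The relations imposed on the generator of the local Weyl module: `(𝔫₊ ⊗ P) v = 0` and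
`(h i ⊗ P) v = (∑ j, P (Z i j)) v`. -/
structure IsHighestWeightVector (Z : LambdaMultiset b A lam) {V : Type*} [AddCommGroup V]
    [Module ℂ V] [LieRingModule (A ⊗[ℂ] L) V] (v : V) : Prop where
  nPlus_lie : ∀ x ∈ nPlus b, ∀ P : A, ⁅P ⊗ₜ[ℂ] x, v⁆ = 0
  coroot_lie : ∀ (i : b.support) (P : A),
    ⁅P ⊗ₜ[ℂ] (simpleCoroot b i : L), v⁆ = ((Z.points i).map fun z => z P).sum • v

/-- `V` is an integrable `𝔤 ⊗ A`-module generated by `v`, and `v` satisfies the relations. -/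
structure IsIntegrableHighestWeight (Z : LambdaMultiset b A lam) (V : Type*) [AddCommGroup V]
    [Module ℂ V] [LieRingModule (A ⊗[ℂ] L) V] [LieModule ℂ (A ⊗[ℂ] L) V] (v : V) : Prop where
  integrable : IsIntegrable H A V
  generated : LieSubmodule.lieSpan ℂ (A ⊗[ℂ] L) {v} = ⊤
  highest : IsHighestWeightVector Z v

/-- `V` with generator `v` is the maximal module with the properties above: any other one (in any
universe `w`) is a quotient of it, the generator being mapped to the generator. -/
structure IsLocalWeylModule (Z : LambdaMultiset b A lam) (V : Type*) [AddCommGroup V]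
    [Module ℂ V] [LieRingModule (A ⊗[ℂ] L) V] [LieModule ℂ (A ⊗[ℂ] L) V] (v : V) : Prop
    extends IsIntegrableHighestWeight Z V v where
  maximal : ∀ (N : Type w) [AddCommGroup N] [Module ℂ N] [LieRingModule (A ⊗[ℂ] L) N]
    [LieModule ℂ (A ⊗[ℂ] L) N] (n : N), IsIntegrableHighestWeight Z N n →
    ∃ f : V →ₗ⁅ℂ, A ⊗[ℂ] L⁆ N, Function.Surjective f ∧ f v = n

/-- The intersection of all left ideals `J` of `U(𝔤 ⊗ A)` for which `U(𝔤 ⊗ A) / J` is integrable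
and its generator satisfies the relations. -/
def weylIdeal (Z : LambdaMultiset b A lam) : LeftIdeal (A ⊗[ℂ] L) :=
  sInf {J | IsIntegrable H A (CyclicModule J) ∧
    IsHighestWeightVector Z (CyclicModule.gen J)}

/-- The local Weyl module `W_M(Z)`. -/
abbrev WeylModule (Z : LambdaMultiset b A lam) : Type _ := CyclicModule (weylIdeal Z)

/-- The generator of `W_M(Z)`. -/
abbrev WeylModule.gen (Z : LambdaMultiset b A lam) : WeylModule Z := CyclicModule.gen (weylIdeal Z)

end Weyl

end LocalWeyl

end

/-! Existence. The candidate is `U(𝔤 ⊗ A) / J`, with `J` the intersection of all admissible left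
ideals. The annihilator of the generator of any competing module is itself admissible, so maximality
is immediate. What needs proof is that the quotient by an intersection is still integrable, which
requires one finite set of weights serving all admissible quotients. In such a quotient every weight
lies in `lam - Q₊` (`iSup_weightSpace_eq_top`), and `sl₂`-theory makes the set of weights stable
under the Weyl group (`weightSpace_smul_ne_bot`). Orbit sums vanish, so the heights of `lam - g • μ`
over the group add up to the constant `|W| ht(lam)`. This leaves finitely many `μ`
(`finite_setOf_forall_sub_smul_mem_posCone`).

Tensor product. An integrable highest weight module is killed by `𝔤 ⊗ Iⁿ` for some `n`, where `I` is
the ideal of functions vanishing at its points (`exists_pow_smul_lie`). Disjoint multisets have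
coprime ideals, so there are `s + t = 1` such that `𝔤 ⊗ s` kills `W(Z)`, `𝔤 ⊗ t` kills `W(Z')` and
`𝔤 ⊗ st` kills `W(Z ∪ Z')` (`exists_comaximal`). Hence `v ⊗ v'` generates the tensor product, which
is then a quotient of `W(Z ∪ Z')`. Conversely, on `W(Z ∪ Z')` the maps `x ↦ t x` and `x ↦ s x` are
commuting representations with sum the given action, for which the generator satisfies the relations
of `Z` and of `Z'` respectively. This gives a homomorphism from `W(Z) ⊗ W(Z')`
(`exists_hom_tensorProduct`). Both maps match generators, so they are mutually inverse. -/

noncomputable section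

/-! ### Root systems: finitely many Weyl orbits below a given weight -/

namespace RootPairing

variable {ι K M N : Type*} [Finite ι] [Field K] [AddCommGroup M] [Module K M]
  [AddCommGroup N] [Module K N] (P : RootPairing ι K M N) [P.IsRootSystem]

/-- The Weyl group of a finite root system is finite: it acts faithfully on the roots. -/
theorem finite_weylGroup : Finite P.weylGroup := by
  refine Finite.of_injective P.weylGroupToPerm fun g g' h => ?_
  apply Subtype.ext
  apply RootPairing.Equiv.weightHom_injective P
  apply LinearEquiv.toLinearMap_injective
  refine LinearMap.ext_on_range (v := P.root) IsRootSystem.span_root_eq_top fun i => ?_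
  have h1 := P.weylGroup_apply_root g i
  have h2 := P.weylGroup_apply_root g' i
  rw [h] at h1
  exact h1.trans h2.symm

omit [Finite ι] in
/-- The sum over a Weyl group orbit vanishes. -/
theorem sum_weylGroup_smul [CharZero K] [Fintype P.weylGroup] (m : M) :
    ∑ g : P.weylGroup, g • m = 0 := by
  set S := ∑ g : P.weylGroup, g • m with hS
  -- Left translation permutes the summands, so `S` is invariant. A vector fixed by a reflection
  -- pairs to zero with its coroot, and the coroots span.
  have hinv (i : ι) : P.reflection i S = S := by
    have : weylGroup.ofIdx P i • S = S := by
      rw [hS, Finset.smul_sum]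
      simp_rw [← mul_smul]
      exact Fintype.sum_equiv (Equiv.mulLeft (weylGroup.ofIdx P i)) _ _ fun g => rfl
    rwa [weylGroup.ofIdx_smul, Equiv.reflection_smul] at this
  have hz (i : ι) : P.toLinearMap S (P.coroot i) = 0 := by
    have h := hinv i
    rw [reflection_apply, sub_eq_self] at h
    exact (smul_eq_zero.mp h).resolve_right (P.ne_zero i)
  have : P.toLinearMap S = 0 := LinearMap.ext_on_range IsRootSystem.span_coroot_eq_top fun i => by
    simpa using hz i
  exact P.toPerfPair.injective (by ext x; simpa using LinearMap.congr_fun this x)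

namespace Base

variable {P} (b : P.Base)

/-- The cone `Q₊` of sums of simple roots. -/
def posCone : AddSubmonoid M := AddSubmonoid.closure (P.root '' b.support)

omit [Finite ι] [P.IsRootSystem] in
theorem root_mem_posCone [CharZero K] {i : ι} (hi : b.IsPos i) : P.root i ∈ b.posCone := by
  obtain ⟨f, -, h | h⟩ := b.exists_root_eq_sum_nat_or_neg i
  · rw [h]
    exact sum_mem fun j hj => nsmul_mem
      (AddSubmonoid.subset_closure (Set.mem_image_of_mem _ hj) : P.root j ∈ b.posCone) _
  · have h2 : P.root i = ∑ j ∈ b.support, (-(f j : ℤ)) • P.root j := by simpa using h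
    rw [isPos_iff, height_eq_sum h2, Finset.sum_neg_distrib, neg_pos] at hi
    exact absurd hi (not_lt.mpr (Finset.sum_nonneg fun _ _ => by positivity))

/-- The linear functional taking the value `1` on all simple roots. -/
def heightFunctional : M →ₗ[K] K := b.toWeightBasis.constr K fun _ => (1 : K)

omit [Finite ι] in
theorem exists_of_mem_posCone {x : M} (hx : x ∈ b.posCone) :
    ∃ n : b.support → ℕ, x = ∑ i, n i • P.root i ∧ b.heightFunctional x = ∑ i, (n i : K) := by
  rw [posCone, ← Submodule.span_nat_eq_addSubmonoidClosure, Submodule.mem_toAddSubmonoid,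
    Fintype.mem_span_image_iff_exists_fun] at hx
  obtain ⟨n, rfl⟩ := hx
  refine ⟨n, rfl, ?_⟩
  have h (i : b.support) : b.heightFunctional (P.root i) = 1 := by
    rw [← b.toWeightBasis_apply, heightFunctional, Module.Basis.constr_basis]
  simp only [map_sum, map_nsmul]
  refine Finset.sum_congr rfl fun i _ => ?_
  rw [h]; simp

/-- Only finitely many elements have their whole Weyl group orbit below a given one. -/
theorem finite_setOf_forall_sub_smul_mem_posCone [CharZero K] (lam : M) :
    {μ : M | ∀ g : P.weylGroup, lam - g • μ ∈ b.posCone}.Finite := by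
  classical
  have := P.finite_weylGroup
  have := Fintype.ofFinite P.weylGroup
  -- The number `|W| ht(lam)` is the total height of all `lam - g • μ`. If it is a natural number
  -- `k`, it bounds every coefficient of `lam - μ`, leaving a finite box. If it is not, no `μ`
  -- qualifies.
  by_cases hN : ∃ n : ℕ, (Fintype.card P.weylGroup : K) * b.heightFunctional lam = n
  · obtain ⟨k, hk⟩ := hN
    refine ((Set.finite_Icc (0 : b.support → ℕ) fun _ => k).image
      fun n => lam - ∑ i : b.support, n i • P.root i).subset fun μ hμ => ?_
    choose n hn hn' using fun g => b.exists_of_mem_posCone (hμ g)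
    refine ⟨n 1, ⟨fun _ => Nat.zero_le _, fun i => ?_⟩, ?_⟩
    · have h1 : ∑ g : P.weylGroup, b.heightFunctional (lam - g • μ) = k := by
        rw [← map_sum, Finset.sum_sub_distrib, P.sum_weylGroup_smul, sub_zero, ← hk]
        simp
      simp_rw [hn'] at h1
      have h2 : ∑ g : P.weylGroup, ∑ i, n g i = k := by exact_mod_cast h1
      rw [← h2]
      calc n 1 i ≤ ∑ i, n 1 i := Finset.single_le_sum (f := n 1) (fun _ _ => Nat.zero_le _)
            (Finset.mem_univ i)
        _ ≤ _ := Finset.single_le_sum (f := fun g => ∑ i, n g i) (fun _ _ => Nat.zero_le _)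
            (Finset.mem_univ 1)
    · have := hn 1
      rw [one_smul] at this
      simp only [← this, sub_sub_cancel]
  · refine Set.Finite.subset Set.finite_empty fun μ hμ => hN ?_
    choose n hn hn' using fun g => b.exists_of_mem_posCone (hμ g)
    refine ⟨∑ g, ∑ i, n g i, ?_⟩
    push_cast
    simp_rw [← hn']
    rw [← map_sum, Finset.sum_sub_distrib, P.sum_weylGroup_smul, sub_zero,
      Finset.sum_const, Finset.card_univ, map_nsmul, nsmul_eq_mul]

end Base

end RootPairing

/-- A member outside `s` would be disjoint from a join that is already everything. Applied to weight
spaces, this puts every actual weight into any set of weights whose spaces span. -/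
theorem iSupIndep.mem_of_ne_bot {α ι : Type*} [CompleteLattice α] {f : ι → α} (hf : iSupIndep f)
    {s : Set ι} (hs : ⨆ i ∈ s, f i = ⊤) {j : ι} (hj : f j ≠ ⊥) : j ∈ s := by
  by_contra h
  refine hj ((hf j).eq_bot_of_le ?_)
  refine le_top.trans (hs.ge.trans (iSup₂_mono' fun i hi => ⟨i, ?_, le_rfl⟩))
  rintro rfl
  exact h hi

namespace LocalWeyl

open LieAlgebra LieAlgebra.IsKilling LieModule

variable {L : Type*} [LieRing L] [LieAlgebra ℂ L] [FiniteDimensional ℂ L]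
  [LieAlgebra.IsSemisimple ℂ L]
  {H : LieSubalgebra ℂ L} [H.IsCartanSubalgebra]

/-! ### Triangular decomposition and integral weights -/

section Roots

omit [IsSemisimple ℂ L] in
theorem mem_rootSpace_neg_toLinear {α : Weight ℂ H L} {x : L} :
    x ∈ rootSpace H ⇑(-α.toLinear) ↔ x ∈ rootSpace H (-⇑α) := by
  have h : (⇑(-α.toLinear) : H → ℂ) = -⇑α := rfl
  rw [h]

/-- The coroot of `α` separates the points of the string, since it takes the value `2` on `α`. An
infinite string of weights thus contradicts integrability. -/
theorem add_nsmul_toLinear_injective {α : Weight ℂ H L} (hα : α.IsNonZero)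
    (μ : Module.Dual ℂ H) : Function.Injective fun k : ℕ => μ + k • α.toLinear := by
  intro k l hkl
  have h := LinearMap.congr_fun (add_left_cancel hkl) (coroot α)
  rw [LinearMap.smul_apply, LinearMap.smul_apply, Weight.toLinear_apply, root_apply_coroot hα,
    nsmul_eq_mul, nsmul_eq_mul] at h
  exact Nat.cast_injective (mul_right_cancel₀ two_ne_zero h)

variable (b : (rootSystem H).Base)

/-- Induction over the triangular decomposition of the semisimple Lie algebra. -/
theorem triangular_induction {p : L → Prop} (zero : p 0) (add : ∀ x y, p x → p y → p (x + y))
    (cartan : ∀ h : H, p h)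
    (pos : ∀ α : H.root, b.IsPos α → ∀ x ∈ rootSpace H (α : Weight ℂ H L), p x)
    (neg : ∀ α : H.root, b.IsPos α → ∀ x ∈ rootSpace H ⇑(-(α : Weight ℂ H L).toLinear), p x)
    (x : L) : p x := by
  have hx : x ∈ (⨆ χ : Weight ℂ H L, (genWeightSpace L χ).toSubmodule) := by
    rw [← LieSubmodule.iSup_toSubmodule, iSup_genWeightSpace_eq_top' ℂ H L]
    trivial
  induction hx using Submodule.iSup_induction' with
  | zero => exact zero
  | add x y _ _ hx hy => exact add x y hx hy
  | mem χ x hx =>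
    by_cases h0 : χ.IsZero
    · have hx0 : x ∈ rootSpace H (0 : H → ℂ) := by rw [← (h0 : (χ : H → ℂ) = 0)]; exact hx
      rw [rootSpace_zero_eq] at hx0
      exact cartan ⟨x, hx0⟩
    · have hχ : χ ∈ H.root := by simpa using h0
      have hneg : b.IsPos ⟨χ, hχ⟩ ∨ b.IsPos ((rootSystem H).reflectionPerm ⟨χ, hχ⟩ ⟨χ, hχ⟩) :=
        RootPairing.Base.IsPos.or_neg b ⟨χ, hχ⟩
      rcases hneg with h | h
      · exact pos ⟨χ, hχ⟩ h x hx
      · refine neg _ h x ?_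
        have h2 := (rootSystem H).root_reflectionPerm ⟨χ, hχ⟩ ⟨χ, hχ⟩
        rw [RootPairing.reflection_apply_self, rootSystem_root_apply, rootSystem_root_apply] at h2
        rw [h2, neg_neg]
        exact hx

theorem span_simpleCoroot : Submodule.span ℂ (Set.range (simpleCoroot b)) = ⊤ := by
  have h : simpleCoroot b = b.toCoweightBasis := by
    ext i : 1
    rw [RootPairing.Base.toCoweightBasis_apply]
    rfl
  rw [h, Module.Basis.span_eq]

theorem rootSpace_le_nPlus {α : H.root} (hα : b.IsPos α) {x : L}
    (hx : x ∈ rootSpace H (α : Weight ℂ H L)) : x ∈ nPlus b :=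
  Submodule.mem_iSup_of_mem α (Submodule.mem_iSup_of_mem hα hx)

/-- A functional taking integral values on the simple coroots is an integral weight. -/
theorem isIntegralWeight_of_simpleCoroot {μ : Module.Dual ℂ H}
    (h : ∀ i, ∃ n : ℤ, μ (simpleCoroot b i) = n) : IsIntegralWeight μ := by
  intro α
  have hα := b.coroot_mem_span_int α
  generalize (rootSystem H).coroot α = x at hα
  induction hα using Submodule.span_induction with
  | zero => exact ⟨0, by simp⟩
  | mem x hx =>
    obtain ⟨i, hi, rfl⟩ := hx
    exact h ⟨i, hi⟩
  | add x y _ _ hx hy =>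
    obtain ⟨m, hm⟩ := hx
    obtain ⟨n, hn⟩ := hy
    exact ⟨m + n, by simp [hm, hn]⟩
  | smul c x _ hx =>
    obtain ⟨m, hm⟩ := hx
    exact ⟨c * m, by simp [hm]⟩

theorem IsIntegralWeight.add {μ ν : Module.Dual ℂ H} (hμ : IsIntegralWeight μ)
    (hν : IsIntegralWeight ν) : IsIntegralWeight (μ + ν) := fun α => by
  obtain ⟨m, hm⟩ := hμ α
  obtain ⟨n, hn⟩ := hν α
  exact ⟨m + n, by rw [LinearMap.add_apply, hm, hn]; push_cast; rfl⟩

theorem IsIntegralWeight.neg {μ : Module.Dual ℂ H} (hμ : IsIntegralWeight μ) :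
    IsIntegralWeight (-μ) := fun α => by
  obtain ⟨m, hm⟩ := hμ α
  exact ⟨-m, by rw [LinearMap.neg_apply, hm]; push_cast; rfl⟩

theorem LambdaMultiset.isIntegralWeight {b : (rootSystem H).Base} {A : Type*} [CommRing A]
    [Algebra ℂ A] {lam : Module.Dual ℂ H} (Z : LambdaMultiset b A lam) : IsIntegralWeight lam :=
  isIntegralWeight_of_simpleCoroot b fun i => ⟨Multiset.card (Z.points i), by
    rw [← Z.card_points i]; simp⟩

end Roots

/-! ### Weight spaces and Weyl group symmetry of integrable modules -/

section Weights

variable {A : Type*} [CommRing A] [Algebra ℂ A]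
  {V : Type*} [AddCommGroup V] [Module ℂ V] [LieRingModule (A ⊗[ℂ] L) V]
  [LieModule ℂ (A ⊗[ℂ] L) V]

omit [FiniteDimensional ℂ L] [IsSemisimple ℂ L] [H.IsCartanSubalgebra] in
theorem mem_weightSpace {μ : Module.Dual ℂ H} {v : V} :
    v ∈ weightSpace H A V μ ↔ ∀ h : H, ⁅(1 : A) ⊗ₜ[ℂ] (h : L), v⁆ = μ h • v := Iff.rfl

-- The Cartan subalgebra is abelian, so the operators `1 ⊗ h` commute. Their weight spaces sit
-- inside simultaneous generalized eigenspaces, which are independent.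
variable (H A V) in
theorem iSupIndep_weightSpace : iSupIndep (weightSpace H A V) := by
  let f : H → Module.End ℂ V := fun h => toEnd ℂ (A ⊗[ℂ] L) V ((1 : A) ⊗ₜ[ℂ] (h : L))
  have hcomm (h h' : H) : Commute (f h) (f h') := by
    ext v
    have h0 : ⁅(h : L), (h' : L)⁆ = 0 := by
      rw [← LieSubalgebra.coe_bracket, trivial_lie_zero, ZeroMemClass.coe_zero]
    have := leibniz_lie ((1 : A) ⊗ₜ[ℂ] (h : L)) ((1 : A) ⊗ₜ[ℂ] (h' : L)) v
    rw [LieAlgebra.ExtendScalars.bracket_tmul, h0, TensorProduct.tmul_zero, zero_lie,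
      zero_add] at this
    exact this
  have hind := Module.End.independent_iInf_maxGenEigenspace_of_forall_mapsTo f
    fun i j φ => Module.End.mapsTo_maxGenEigenspace_of_comm (hcomm j i) φ
  refine (hind.comp (DFunLike.coe_injective (F := Module.Dual ℂ H))).mono fun μ v hv => ?_
  simp only [Function.comp_apply, Submodule.mem_iInf]
  intro h
  refine Module.End.genEigenspace_le_maximal (f h) (μ h) 1 ?_
  rw [Nat.cast_one, Module.End.mem_genEigenspace_one]
  exact hv h

theorem lie_mem_weightSpace {χ μ : Module.Dual ℂ H} {x : L} (hx : x ∈ rootSpace H χ) {v : V}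
    (hv : v ∈ weightSpace H A V μ) (a : A) : ⁅a ⊗ₜ[ℂ] x, v⁆ ∈ weightSpace H A V (μ + χ) := by
  intro h
  have h1 : ⁅(h : L), x⁆ = χ h • x := lie_eq_smul_of_mem_rootSpace hx h
  rw [leibniz_lie, LieAlgebra.ExtendScalars.bracket_tmul, h1, one_mul, hv h,
    TensorProduct.tmul_smul, smul_lie, lie_smul, ← add_smul, LinearMap.add_apply, add_comm]

/-- In an integrable module the set of weights is stable under subtracting `n α`, where `n` is the
nonnegative value on the coroot of `α`. -/
theorem IsIntegrable.weightSpace_sub_nsmul_ne_bot (hV : IsIntegrable H A V) {α : Weight ℂ H L}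
    (hα : α.IsNonZero) {μ : Module.Dual ℂ H} (hμ : weightSpace H A V μ ≠ ⊥) {n : ℕ}
    (hn : μ (coroot α) = n) : weightSpace H A V (μ - n • α.toLinear) ≠ ⊥ := by
  obtain ⟨D, -, hD⟩ := hV
  obtain ⟨h, e, f, ht, he, hf⟩ := exists_isSl2Triple_of_weight_isNonZero hα
  have hh : h = coroot α := ht.h_eq_coroot hα he hf
  rw [← mem_rootSpace_neg_toLinear] at hf
  replace he : e ∈ rootSpace H α.toLinear := he
  -- Restriction along `x ↦ 1 ⊗ x` makes the theory of primitive vectors for `sl₂`-triples in `L`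
  -- available.
  let φ : L →ₗ⁅ℂ⁆ A ⊗[ℂ] L :=
    { TensorProduct.mk ℂ A L 1 with
      map_lie' := fun {x y} => by simp }
  let := LieRingModule.compLieHom V φ
  have := LieModule.compLieHom V φ
  have hlie (x : L) (v : V) : ⁅x, v⁆ = ⁅(1 : A) ⊗ₜ[ℂ] x, v⁆ := rfl
  have hmemE {χ : Module.Dual ℂ H} {v : V} (hv : v ∈ weightSpace H A V χ) (k : ℕ) :
      ((toEnd ℂ L V e) ^ k) v ∈ weightSpace H A V (χ + k • α.toLinear) := by
    induction k with
    | zero => simpa using hv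
    | succ k ih =>
      rw [pow_succ', succ_nsmul, ← add_assoc]
      exact lie_mem_weightSpace he ih 1
  have hmemF {χ : Module.Dual ℂ H} {v : V} (hv : v ∈ weightSpace H A V χ) (k : ℕ) :
      ((toEnd ℂ L V f) ^ k) v ∈ weightSpace H A V (χ - k • α.toLinear) := by
    induction k with
    | zero => simpa using hv
    | succ k ih =>
      rw [pow_succ', succ_nsmul, ← sub_sub, sub_eq_add_neg _ α.toLinear]
      exact lie_mem_weightSpace (χ := -α.toLinear) hf ih 1
  obtain ⟨v, hv, hv0⟩ := Submodule.exists_mem_ne_zero_of_ne_bot hμ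
  -- Otherwise all `μ + k α` would be weights, and there are infinitely many of them.
  have hnil : ∃ k, ((toEnd ℂ L V e) ^ k) v = 0 := by
    by_contra! hne
    refine Set.infinite_of_injective_forall_mem (f := fun k : ℕ => μ + k • α.toLinear) 
      (add_nsmul_toLinear_injective hα μ) (fun k => ?_) D.finite_toSet
    exact (iSupIndep_weightSpace H A V).mem_of_ne_bot hD
        fun hb => hne k ((Submodule.mem_bot ℂ).mp (hb.le (hmemE hv k)))
  -- The last nonzero `u = eᵏ v` is primitive of `h`-weight `n + 2k`. Since `n + k ≤ n + 2k`, the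
  -- vector `f ^ (n + k) u` is nonzero, and its weight is `μ + k α - (n + k) α = μ - n α`.
  obtain ⟨k, hk, hk'⟩ := Nat.exists_not_and_succ_of_not_zero_of_exists (by simpa using hv0) hnil
  have hu := hmemE hv k
  rw [pow_succ', Module.End.mul_apply, toEnd_apply_apply] at hk'
  generalize ((toEnd ℂ L V e) ^ k) v = u at hu hk hk'
  have hval : (μ + k • α.toLinear) (coroot α) = ((n + 2 * k : ℕ) : ℂ) := by
    rw [LinearMap.add_apply, LinearMap.smul_apply, Weight.toLinear_apply, root_apply_coroot hα, hn]
    push_cast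
    rw [nsmul_eq_mul, mul_comm]
  have hlh : ⁅h, u⁆ = ((n + 2 * k : ℕ) : ℂ) • u := by
    rw [hlie, hh, ← hval]
    exact hu (coroot α)
  have hP : ht.HasPrimitiveVectorWith u ((n + 2 * k : ℕ) : ℂ) := ⟨hk, hlh, hk'⟩
  have hne := hP.pow_toEnd_f_ne_zero_of_eq_nat rfl (i := n + k) (by omega)
  intro hb
  refine hne ?_
  have := hmemF hu (n + k)
  rw [add_smul, add_comm (n • _), ← sub_sub, add_sub_cancel_right] at this
  exact (Submodule.mem_bot ℂ).mp (hb.le this)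

theorem IsIntegrable.weightSpace_reflection_ne_bot (hV : IsIntegrable H A V) (α : H.root)
    {μ : Module.Dual ℂ H} (hμ : weightSpace H A V μ ≠ ⊥) :
    weightSpace H A V ((rootSystem H).reflection α μ) ≠ ⊥ := by
  obtain ⟨n, hn⟩ : ∃ n : ℤ, μ (coroot (α : Weight ℂ H L)) = n := by
    obtain ⟨D, hD, hD'⟩ := hV
    exact hD μ ((iSupIndep_weightSpace H A V).mem_of_ne_bot hD' hμ) α
  have hα : (α : Weight ℂ H L).IsNonZero := (Finset.mem_filter.mp α.2).2
  have hr : (rootSystem H).reflection α μ = μ - n • (α : Weight ℂ H L).toLinear := by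
    rw [← Int.cast_smul_eq_zsmul ℂ, ← hn]
    rfl
  rw [hr]
  -- A negative value on the coroot of `α` is a positive one on that of `-α`, and both roots give
  -- the same reflection.
  obtain ⟨m, rfl | rfl⟩ := n.eq_nat_or_neg
  · rw [natCast_zsmul]
    exact hV.weightSpace_sub_nsmul_ne_bot hα hμ (by simpa using hn)
  · have := hV.weightSpace_sub_nsmul_ne_bot hα.neg hμ (n := m) (by rw [coroot_neg]; simp [hn])
    rwa [Weight.toLinear_neg, smul_neg, ← natCast_zsmul, ← neg_smul] at this

theorem IsIntegrable.weightSpace_smul_ne_bot (hV : IsIntegrable H A V)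
    (g : (rootSystem H).weylGroup) {μ : Module.Dual ℂ H} (hμ : weightSpace H A V μ ≠ ⊥) :
    weightSpace H A V (g • μ) ≠ ⊥ := by
  obtain ⟨g, hg⟩ := g
  change weightSpace H A V (g • μ) ≠ ⊥
  induction hg using RootPairing.weylGroup.induction generalizing μ with
  | mem i => exact hV.weightSpace_reflection_ne_bot i hμ
  | one => rwa [one_smul]
  | mul x y _ _ hx hy =>
    rw [mul_smul]
    exact hx (hy hμ)

end Weights

/-! ### Highest weight modules and the bound on their weights -/

section HighestWeight

variable {b : (rootSystem H).Base} {A : Type*} [CommRing A] [Algebra ℂ A]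
  {lam : Module.Dual ℂ H} {Z : LambdaMultiset b A lam}
  {V : Type*} [AddCommGroup V] [Module ℂ V] [LieRingModule (A ⊗[ℂ] L) V]
  [LieModule ℂ (A ⊗[ℂ] L) V] {v : V}

theorem IsHighestWeightVector.lie_cartan_mem (hv : IsHighestWeightVector Z v) (h : H) (P : A) :
    ⁅P ⊗ₜ[ℂ] (h : L), v⁆ ∈ Submodule.span ℂ {v} := by
  have hh : h ∈ Submodule.span ℂ (Set.range (simpleCoroot b)) := by
    rw [span_simpleCoroot]; trivial
  induction hh using Submodule.span_induction with
  | zero => simp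
  | mem x hx =>
    obtain ⟨i, rfl⟩ := hx
    rw [hv.coroot_lie]
    exact Submodule.smul_mem _ _ (Submodule.mem_span_singleton_self v)
  | add x y _ _ hx hy =>
    rw [AddMemClass.coe_add, TensorProduct.tmul_add, add_lie]
    exact add_mem hx hy
  | smul c x _ hx =>
    rw [SetLike.val_smul, TensorProduct.tmul_smul, smul_lie]
    exact Submodule.smul_mem _ _ hx

theorem IsHighestWeightVector.mem_weightSpace (hv : IsHighestWeightVector Z v) :
    v ∈ weightSpace H A V lam := by
  intro h
  have hh : h ∈ Submodule.span ℂ (Set.range (simpleCoroot b)) := by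
    rw [span_simpleCoroot]; trivial
  induction hh using Submodule.span_induction with
  | zero => simp
  | mem x hx =>
    obtain ⟨i, rfl⟩ := hx
    rw [hv.coroot_lie, ← Z.card_points i]
    simp
  | add x y _ _ hx hy =>
    rw [AddMemClass.coe_add, TensorProduct.tmul_add, add_lie, hx, hy, map_add, add_smul]
  | smul c x _ hx =>
    rw [SetLike.val_smul, TensorProduct.tmul_smul, smul_lie, hx, map_smul, smul_eq_mul,
      mul_smul]

/-- A subspace that contains a generating highest weight vector and is stable under the negative
root spaces is everything. -/
theorem IsHighestWeightVector.eq_top_of_stable (hv : IsHighestWeightVector Z v)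
    (hgen : LieSubmodule.lieSpan ℂ (A ⊗[ℂ] L) {v} = ⊤) {F : Submodule ℂ V} (hvF : v ∈ F)
    (hF : ∀ α : H.root, b.IsPos α → ∀ y ∈ rootSpace H ⇑(-(α : Weight ℂ H L).toLinear),
      ∀ (a : A), ∀ u ∈ F, ⁅a ⊗ₜ[ℂ] y, u⁆ ∈ F) : F = ⊤ := by
  let S : Set (Submodule ℂ V) := {F | v ∈ F ∧ ∀ α : H.root, b.IsPos α →
    ∀ y ∈ rootSpace H ⇑(-(α : Weight ℂ H L).toLinear), ∀ (a : A), ∀ u ∈ F, ⁅a ⊗ₜ[ℂ] y, u⁆ ∈ F}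
  have hS : sInf S ∈ S := by
    refine ⟨Submodule.mem_sInf.mpr fun F hF => hF.1, fun α hα y hy a u hu => ?_⟩
    exact Submodule.mem_sInf.mpr fun F hF => hF.2 α hα y hy a u (Submodule.mem_sInf.mp hu F hF)
  -- Instead of a PBW argument: `sInf S` is the smallest admissible subspace, and `G` consists of
  -- its vectors that the whole Lie algebra keeps inside it. The Leibniz rule shows that `G` is
  -- admissible too. By minimality `sInf S` is then a submodule, and as it contains the generator it
  -- is everything.
  let G : Submodule ℂ V :=
    sInf S ⊓ ⨅ x : A ⊗[ℂ] L, (sInf S).comap (toEnd ℂ (A ⊗[ℂ] L) V x)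
  have hmem (u : V) : u ∈ G ↔ u ∈ sInf S ∧ ∀ x : A ⊗[ℂ] L, ⁅x, u⁆ ∈ sInf S := by
    simp [G, -Submodule.mem_sInf]
  have hG : G ∈ S := by
    refine ⟨(hmem v).mpr ⟨hS.1, fun x => ?_⟩, fun α hα y hy a u hu => ?_⟩
    · induction x with
      | zero => rw [zero_lie]; exact zero_mem _
      | add x y hx hy => rw [add_lie]; exact add_mem hx hy
      | tmul a x =>
        induction x using triangular_induction b with
        | zero => rw [TensorProduct.tmul_zero, zero_lie]; exact zero_mem _
        | add x y hx hy => rw [TensorProduct.tmul_add, add_lie]; exact add_mem hx hy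
        | cartan h =>
          exact (Submodule.span_singleton_le_iff_mem _ _).mpr hS.1 (hv.lie_cartan_mem h a)
        | pos α hα x hx => rw [hv.nPlus_lie x (rootSpace_le_nPlus b hα hx)]; exact zero_mem _
        | neg α hα x hx => exact hS.2 α hα x hx a v hS.1
    · rw [hmem] at hu ⊢
      refine ⟨hu.2 _, fun x => ?_⟩
      rw [leibniz_lie]
      exact add_mem (hu.2 _) (hS.2 α hα y hy a _ (hu.2 x))
  have hle : sInf S ≤ G := sInf_le hG
  let N : LieSubmodule ℂ (A ⊗[ℂ] L) V :=
    { sInf S with lie_mem := fun {x u} hu => ((hmem u).mp (hle hu)).2 x }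
  have hN : N = ⊤ := top_le_iff.mp (hgen.ge.trans
    (LieSubmodule.lieSpan_le.mpr (Set.singleton_subset_iff.mpr hS.1)))
  have : sInf S = ⊤ := by
    rw [Submodule.eq_top_iff']
    intro u
    have : u ∈ N := by rw [hN]; trivial
    exact this
  exact top_le_iff.mp (this.ge.trans (sInf_le ⟨hvF, hF⟩))

/-- All weights of a highest weight module lie below the highest weight. -/
theorem IsHighestWeightVector.iSup_weightSpace_eq_top (hv : IsHighestWeightVector Z v)
    (hgen : LieSubmodule.lieSpan ℂ (A ⊗[ℂ] L) {v} = ⊤) :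
    ⨆ μ ∈ {μ | lam - μ ∈ b.posCone}, weightSpace H A V μ = ⊤ := by
  refine hv.eq_top_of_stable hgen ?_ fun α hα y hy a u hu => ?_
  · exact Submodule.mem_iSup_of_mem lam (Submodule.mem_iSup_of_mem (by simp) hv.mem_weightSpace)
  · rw [iSup_subtype'] at hu
    induction hu using Submodule.iSup_induction' with
    | zero => rw [lie_zero]; exact zero_mem _
    | add x y _ _ hx hy => rw [lie_add]; exact add_mem hx hy
    | mem μ x hx =>
      refine Submodule.mem_iSup_of_mem ((μ : Module.Dual ℂ H) + -(α : Weight ℂ H L).toLinear)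
        (Submodule.mem_iSup_of_mem ?_ (lie_mem_weightSpace hy hx a))
      have : lam - ((μ : Module.Dual ℂ H) + -(α : Weight ℂ H L).toLinear) =
        (lam - μ) + (rootSystem H).root α := by rw [rootSystem_root_apply]; abel
      rw [Set.mem_ofPred_eq, this]
      exact add_mem μ.2 (b.root_mem_posCone hα)

variable (b lam) in
/-- A finite set containing all weights of integrable modules with highest weight `lam`. -/
def weightBound : Finset (Module.Dual ℂ H) :=
  (b.finite_setOf_forall_sub_smul_mem_posCone lam).toFinset

/-- The whole orbit of a weight consists of weights, hence lies below `lam`. The bound depends only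
on `b` and `lam`, not on the module. -/
theorem IsIntegrableHighestWeight.mem_weightBound (hV : IsIntegrableHighestWeight Z V v)
    {μ : Module.Dual ℂ H} (hμ : weightSpace H A V μ ≠ ⊥) : μ ∈ weightBound b lam := by
  rw [weightBound, Set.Finite.mem_toFinset]
  intro g
  exact (iSupIndep_weightSpace H A V).mem_of_ne_bot
    (hV.highest.iSup_weightSpace_eq_top hV.generated) (hV.integrable.weightSpace_smul_ne_bot g hμ)

theorem IsIntegrable.isIntegralWeight (hV : IsIntegrable H A V) {μ : Module.Dual ℂ H}
    (hμ : weightSpace H A V μ ≠ ⊥) : IsIntegralWeight μ := by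
  obtain ⟨D, hD, hD'⟩ := hV
  exact hD μ ((iSupIndep_weightSpace H A V).mem_of_ne_bot hD' hμ)

/-- A highest weight module is spanned by its weight spaces anyway, so integrability reduces to
finiteness and integrality of the weights that occur. -/
theorem IsHighestWeightVector.isIntegrable (hv : IsHighestWeightVector Z v)
    (hgen : LieSubmodule.lieSpan ℂ (A ⊗[ℂ] L) {v} = ⊤) {D : Finset (Module.Dual ℂ H)}
    (hD : ∀ μ, weightSpace H A V μ ≠ ⊥ → μ ∈ D ∧ IsIntegralWeight μ) : IsIntegrable H A V := by
  classical
  refine ⟨D.filter IsIntegralWeight, fun μ hμ => (Finset.mem_filter.mp hμ).2, ?_⟩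
  rw [eq_top_iff, ← hv.iSup_weightSpace_eq_top hgen]
  refine iSup₂_le fun μ _ => ?_
  by_cases h : weightSpace H A V μ = ⊥
  · rw [h]; exact bot_le
  · exact le_iSup₂_of_le μ (Finset.mem_filter.mpr (hD μ h)) le_rfl

end HighestWeight

end LocalWeyl

namespace LocalWeyl

open LieAlgebra LieAlgebra.IsKilling LieModule

attribute [local instance 100] LieRing.ofAssociativeRing

/-! ### Enveloping algebras and cyclic modules -/

section Enveloping

variable {K : Type*} [LieRing K] [LieAlgebra ℂ K]

local notation "𝔘" => UniversalEnvelopingAlgebra ℂ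

/-- An induction principle for the universal enveloping algebra. -/
theorem enveloping_induction {p : 𝔘 K → Prop} (scalar : ∀ c : ℂ, p (algebraMap ℂ (𝔘 K) c))
    (ι : ∀ x, p (UniversalEnvelopingAlgebra.ι ℂ x)) (mul : ∀ a b, p a → p b → p (a * b))
    (add : ∀ a b, p a → p b → p (a + b)) (u : 𝔘 K) : p u := by
  let S : Subalgebra ℂ (𝔘 K) :=
    { carrier := {u | p u}
      mul_mem' := fun {a b} => mul a b
      add_mem' := fun {a b} => add a b
      algebraMap_mem' := scalar }
  let j : K →ₗ⁅ℂ⁆ S :=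
    { toFun := fun x => ⟨UniversalEnvelopingAlgebra.ι ℂ x, ι x⟩
      map_add' := fun x y => Subtype.ext (map_add _ x y)
      map_smul' := fun c x => Subtype.ext (map_smul _ c x)
      map_lie' := fun {x y} => Subtype.ext (LieHom.map_lie _ x y) }
  -- By the universal property, lifting into the subalgebra and including back is the identity, so
  -- the subalgebra is everything.
  have h : S.val.comp (UniversalEnvelopingAlgebra.lift ℂ j) = AlgHom.id ℂ (𝔘 K) := by
    ext x
    simp only [LieHom.comp_apply, AlgHom.coe_toLieHom, AlgHom.comp_apply,
      UniversalEnvelopingAlgebra.lift_ι_apply]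
    rfl
  have h2 : S.val (UniversalEnvelopingAlgebra.lift ℂ j u) = u := AlgHom.congr_fun h u
  exact h2 ▸ (UniversalEnvelopingAlgebra.lift ℂ j u).2

namespace CyclicModule

variable (J : LeftIdeal K)

/-- The quotient map from `U(K)` to `U(K) / J`. -/
def mk : 𝔘 K →ₗ[𝔘 K] CyclicModule J := Submodule.mkQ J

theorem mk_surjective : Function.Surjective (mk J) := Submodule.mkQ_surjective J

theorem mk_one : mk J 1 = gen J := rfl

theorem mk_eq_zero {u : 𝔘 K} : mk J u = 0 ↔ u ∈ J := Submodule.Quotient.mk_eq_zero J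

theorem lie_mk (x : K) (u : 𝔘 K) : ⁅x, mk J u⁆ = mk J (UniversalEnvelopingAlgebra.ι ℂ x * u) := rfl

theorem lie_gen (x : K) : ⁅x, gen J⁆ = mk J (UniversalEnvelopingAlgebra.ι ℂ x) := by
  rw [← mk_one, lie_mk, mul_one]

theorem mk_smul (c : ℂ) (u : 𝔘 K) : mk J (c • u) = c • mk J u := rfl

variable {V : Type*} [AddCommGroup V] [Module ℂ V]

variable {J} in
/-- Linear maps out of `U(K) / J`. -/
def lift (f : 𝔘 K →ₗ[ℂ] V) (hf : ∀ u ∈ J, f u = 0) : CyclicModule J →ₗ[ℂ] V where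
  toFun := QuotientAddGroup.lift J.toAddSubgroup f.toAddMonoidHom fun u hu => hf u hu
  map_add' := map_add _
  map_smul' c m := by
    obtain ⟨u, rfl⟩ := mk_surjective J m
    exact map_smul f c u

end CyclicModule

section Representation

variable {V : Type*} [AddCommGroup V] [Module ℂ V] (ρ : K →ₗ⁅ℂ⁆ Module.End ℂ V)

/-- The action of the universal enveloping algebra attached to a representation. -/
def envHom : 𝔘 K →ₐ[ℂ] Module.End ℂ V := UniversalEnvelopingAlgebra.lift ℂ ρ

@[simp]
theorem envHom_ι (x : K) : envHom ρ (UniversalEnvelopingAlgebra.ι ℂ x) = ρ x :=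
  UniversalEnvelopingAlgebra.lift_ι_apply ℂ ρ x

/-- The annihilator of a vector in the universal enveloping algebra. -/
def annIdeal (v : V) : LeftIdeal K where
  carrier := {u | envHom ρ u v = 0}
  add_mem' {a b} ha hb := by
    change envHom ρ (a + b) v = 0
    rw [map_add, LinearMap.add_apply, ha, hb, add_zero]
  zero_mem' := by
    change envHom ρ 0 v = 0
    rw [map_zero, LinearMap.zero_apply]
  smul_mem' c a ha := by
    change envHom ρ (c * a) v = 0
    rw [map_mul, Module.End.mul_apply, ha, map_zero]

theorem mem_annIdeal {v : V} {u : 𝔘 K} : u ∈ annIdeal ρ v ↔ envHom ρ u v = 0 := Iff.rfl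

/-- The embedding of `U(K) / ann v` as the cyclic submodule generated by `v`. -/
def orbitMap (v : V) : CyclicModule (annIdeal ρ v) →ₗ[ℂ] V :=
  CyclicModule.lift ((LinearMap.applyₗ v).comp (envHom ρ).toLinearMap) fun _ hu => hu

@[simp]
theorem orbitMap_mk (v : V) (u : 𝔘 K) :
    orbitMap ρ v (CyclicModule.mk _ u) = envHom ρ u v := rfl

@[simp]
theorem orbitMap_gen (v : V) : orbitMap ρ v (CyclicModule.gen _) = v := by
  rw [← CyclicModule.mk_one, orbitMap_mk, map_one, Module.End.one_apply]

theorem orbitMap_injective (v : V) : Function.Injective (orbitMap ρ v) := by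
  rw [injective_iff_map_eq_zero]
  intro m hm
  obtain ⟨u, rfl⟩ := CyclicModule.mk_surjective _ m
  exact (CyclicModule.mk_eq_zero _).mpr hm

theorem orbitMap_lie (v : V) (x : K) (m : CyclicModule (annIdeal ρ v)) :
    orbitMap ρ v ⁅x, m⁆ = ρ x (orbitMap ρ v m) := by
  obtain ⟨u, rfl⟩ := CyclicModule.mk_surjective _ m
  rw [CyclicModule.lie_mk, orbitMap_mk, orbitMap_mk, map_mul, envHom_ι, Module.End.mul_apply]

theorem envHom_apply_mem {p : Submodule ℂ V} (hp : ∀ x, ∀ w ∈ p, ρ x w ∈ p) {v : V} (hv : v ∈ p)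
    (u : 𝔘 K) : envHom ρ u v ∈ p := by
  induction u using enveloping_induction generalizing v with
  | scalar c =>
    rw [AlgHom.commutes, Module.algebraMap_end_apply]
    exact p.smul_mem c hv
  | ι x => rw [envHom_ι]; exact hp x v hv
  | mul a b ha hb => rw [map_mul]; exact ha (hb hv)
  | add a b ha hb => rw [map_add]; exact add_mem (ha hv) (hb hv)

theorem envHom_commute {W : Type*} [AddCommGroup W] [Module ℂ W] {f : V →ₗ[ℂ] W}
    {σ : K →ₗ⁅ℂ⁆ Module.End ℂ W} (hf : ∀ x v, f (ρ x v) = σ x (f v)) (u : 𝔘 K) (v : V) :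
    f (envHom ρ u v) = envHom σ u (f v) := by
  induction u using enveloping_induction generalizing v with
  | scalar c => simp [Module.algebraMap_end_apply]
  | ι x => rw [envHom_ι, envHom_ι, hf]
  | mul a b ha hb => rw [map_mul, map_mul, Module.End.mul_apply, Module.End.mul_apply, ha, hb]
  | add a b ha hb =>
    rw [map_add, map_add, LinearMap.add_apply, LinearMap.add_apply, map_add, ha, hb]

end Representation

section Module

theorem CyclicModule.envHom_toEnd (J : LeftIdeal K) (u : 𝔘 K) (m : CyclicModule J) :
    envHom (toEnd ℂ K (CyclicModule J)) u m = u • m := by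
  induction u using enveloping_induction generalizing m with
  | scalar c => rw [AlgHom.commutes, Module.algebraMap_end_apply, algebraMap_smul]
  | ι x => rw [envHom_ι]; rfl
  | mul a b ha hb => rw [map_mul, Module.End.mul_apply, ha, hb, mul_smul]
  | add a b ha hb => rw [map_add, LinearMap.add_apply, ha, hb, add_smul]

theorem CyclicModule.envHom_gen (J : LeftIdeal K) (u : 𝔘 K) :
    envHom (toEnd ℂ K (CyclicModule J)) u (gen J) = mk J u := by
  rw [envHom_toEnd, ← mk_one, ← map_smul, smul_eq_mul, mul_one]

theorem CyclicModule.lieSpan_gen (J : LeftIdeal K) : LieSubmodule.lieSpan ℂ K {gen J} = ⊤ := by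
  rw [eq_top_iff]
  intro m _
  obtain ⟨u, rfl⟩ := mk_surjective _ m
  rw [← envHom_gen]
  exact envHom_apply_mem _ (p := (LieSubmodule.lieSpan ℂ K {gen J}).toSubmodule)
    (fun x w hw => LieSubmodule.lie_mem _ hw)
    (LieSubmodule.subset_lieSpan (Set.mem_singleton _)) u

variable {V : Type*} [AddCommGroup V] [Module ℂ V] [LieRingModule K V] [LieModule ℂ K V]

/-- The module homomorphism from a cyclic module that maps the generator to a vector
annihilated by the ideal. -/
def CyclicModule.hom {J : LeftIdeal K} (v : V) (hJ : J ≤ annIdeal (toEnd ℂ K V) v) :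
    CyclicModule J →ₗ⁅ℂ, K⁆ V :=
  { CyclicModule.lift ((LinearMap.applyₗ v).comp (envHom (toEnd ℂ K V)).toLinearMap)
      fun _ hu => hJ hu with
    map_lie' := fun {x m} => by
      obtain ⟨u, rfl⟩ := mk_surjective _ m
      change envHom (toEnd ℂ K V) (UniversalEnvelopingAlgebra.ι ℂ x * u) v =
        ⁅x, envHom (toEnd ℂ K V) u v⁆
      rw [map_mul, envHom_ι]
      rfl }

theorem CyclicModule.hom_gen {J : LeftIdeal K} (v : V) (hJ : J ≤ annIdeal (toEnd ℂ K V) v) :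
    hom v hJ (gen J) = v := by
  change envHom (toEnd ℂ K V) 1 v = v
  rw [map_one, Module.End.one_apply]

omit [LieModule ℂ K V] in
theorem surjective_of_lieSpan_eq_top {W : Type*} [AddCommGroup W] [Module ℂ W]
    [LieRingModule K W] [LieModule ℂ K W] (f : W →ₗ⁅ℂ, K⁆ V) {w : W} {v : V} (hf : f w = v)
    (hv : LieSubmodule.lieSpan ℂ K {v} = ⊤) : Function.Surjective f := by
  rw [← LieModuleHom.range_eq_top, eq_top_iff, ← hv, LieSubmodule.lieSpan_le,
    Set.singleton_subset_iff]
  exact ⟨w, hf⟩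

omit [LieModule ℂ K V] in
theorem hom_eq_of_lieSpan_eq_top {W : Type*} [AddCommGroup W] [Module ℂ W]
    [LieRingModule K W] [LieModule ℂ K W] {f g : W →ₗ⁅ℂ, K⁆ V} {w : W}
    (hw : LieSubmodule.lieSpan ℂ K {w} = ⊤) (hfg : f w = g w) : f = g := by
  have h : (⊤ : LieSubmodule ℂ K W) ≤ (f - g).ker := by
    rw [← hw, LieSubmodule.lieSpan_le, Set.singleton_subset_iff]
    simp [hfg]
  ext m
  have := h (LieSubmodule.mem_top m)
  simpa [sub_eq_zero] using this

end Module

end Enveloping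

/-! ### Existence of local Weyl modules -/

section Weyl

variable {L : Type*} [LieRing L] [LieAlgebra ℂ L] [FiniteDimensional ℂ L]
  [LieAlgebra.IsSemisimple ℂ L]
  {H : LieSubalgebra ℂ L} [H.IsCartanSubalgebra]
  {b : (rootSystem H).Base} {A : Type*} [CommRing A] [Algebra ℂ A]
  {lam : Module.Dual ℂ H} (Z : LambdaMultiset b A lam)

-- The relations are checked after the injective, equivariant `orbitMap`. A bare representation `ρ`
-- is used, rather than a module instance, because several actions on one space are needed later.
variable {Z} in
theorem isHighestWeightVector_annIdeal_gen {V : Type*} [AddCommGroup V] [Module ℂ V]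
    {ρ : A ⊗[ℂ] L →ₗ⁅ℂ⁆ Module.End ℂ V} {v : V}
    (hn : ∀ x ∈ nPlus b, ∀ P : A, ρ (P ⊗ₜ[ℂ] x) v = 0)
    (hc : ∀ (i : b.support) (P : A),
      ρ (P ⊗ₜ[ℂ] (simpleCoroot b i : L)) v = ((Z.points i).map fun z => z P).sum • v) :
    IsHighestWeightVector Z (CyclicModule.gen (annIdeal ρ v)) := by
  refine ⟨fun x hx P => ?_, fun i P => ?_⟩
  · apply orbitMap_injective ρ v
    rw [orbitMap_lie, orbitMap_gen, hn x hx, map_zero]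
  · apply orbitMap_injective ρ v
    rw [orbitMap_lie, orbitMap_gen, hc, map_smul, orbitMap_gen]

/-- The defining ideal of the local Weyl module annihilates every highest weight vector generating
an integrable module. -/
theorem weylIdeal_le_annIdeal {V : Type*} [AddCommGroup V] [Module ℂ V]
    (ρ : A ⊗[ℂ] L →ₗ⁅ℂ⁆ Module.End ℂ V) {v : V}
    (hn : ∀ x ∈ nPlus b, ∀ P : A, ρ (P ⊗ₜ[ℂ] x) v = 0)
    (hc : ∀ (i : b.support) (P : A),
      ρ (P ⊗ₜ[ℂ] (simpleCoroot b i : L)) v = ((Z.points i).map fun z => z P).sum • v)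
    {D : Finset (Module.Dual ℂ H)}
    (hD : ∀ μ : Module.Dual ℂ H, ∀ w ∈ LinearMap.range (orbitMap ρ v), w ≠ 0 →
      (∀ h : H, ρ ((1 : A) ⊗ₜ[ℂ] (h : L)) w = μ h • w) → μ ∈ D ∧ IsIntegralWeight μ) :
    weylIdeal Z ≤ annIdeal ρ v := by
  have hw := isHighestWeightVector_annIdeal_gen hn hc
  refine sInf_le ⟨hw.isIntegrable (CyclicModule.lieSpan_gen _) (D := D) fun μ hμ => ?_, hw⟩
  obtain ⟨m, hm, hm0⟩ := Submodule.exists_mem_ne_zero_of_ne_bot hμ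
  refine hD μ (orbitMap ρ v m) ⟨m, rfl⟩ ?_ fun h => ?_
  · rwa [(map_ne_zero_iff _ (orbitMap_injective ρ v))]
  · rw [← orbitMap_lie, mem_weightSpace.mp hm h, map_smul]

theorem weylIdeal_le_annIdeal_toEnd {V : Type*} [AddCommGroup V] [Module ℂ V]
    [LieRingModule (A ⊗[ℂ] L) V] [LieModule ℂ (A ⊗[ℂ] L) V] {v : V}
    (hV : IsIntegrable H A V) (hv : IsHighestWeightVector Z v) :
    weylIdeal Z ≤ annIdeal (toEnd ℂ (A ⊗[ℂ] L) V) v := by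
  obtain ⟨D, hD, hD'⟩ := id hV
  refine weylIdeal_le_annIdeal Z _ hv.nPlus_lie hv.coroot_lie (D := D) fun μ w _ hw0 hw => ?_
  have hμ : weightSpace H A V μ ≠ ⊥ := fun hb => hw0 ((Submodule.mem_bot ℂ).mp (hb.le hw))
  have := (iSupIndep_weightSpace H A V).mem_of_ne_bot hD' hμ
  exact ⟨this, hD μ this⟩

theorem isHighestWeightVector_weylGen : IsHighestWeightVector Z (WeylModule.gen Z) := by
  refine ⟨fun x hx P => ?_, fun i P => ?_⟩
  · rw [CyclicModule.lie_gen, CyclicModule.mk_eq_zero]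
    refine Submodule.mem_sInf.mpr fun J hJ => ?_
    rw [← CyclicModule.mk_eq_zero, ← CyclicModule.lie_gen]
    exact hJ.2.nPlus_lie x hx P
  · rw [WeylModule.gen, CyclicModule.lie_gen, ← sub_eq_zero, ← CyclicModule.mk_one,
      ← CyclicModule.mk_smul, ← map_sub, CyclicModule.mk_eq_zero]
    refine Submodule.mem_sInf.mpr fun J hJ => ?_
    rw [← CyclicModule.mk_eq_zero, map_sub, CyclicModule.mk_smul, CyclicModule.mk_one,
      ← CyclicModule.lie_gen, sub_eq_zero]
    exact hJ.2.coroot_lie i P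

/-- A nonzero weight vector modulo the intersection stays nonzero modulo some admissible `J`. Its
weight is therefore a weight of an integrable highest weight module, and so lies in the uniform set
`weightBound`. -/
theorem isIntegrable_weylModule : IsIntegrable H A (WeylModule Z) := by
  refine (isHighestWeightVector_weylGen Z).isIntegrable (CyclicModule.lieSpan_gen _)
    (D := weightBound b lam) fun μ hμ => ?_
  obtain ⟨m, hm, hm0⟩ := Submodule.exists_mem_ne_zero_of_ne_bot hμ
  obtain ⟨u, rfl⟩ := CyclicModule.mk_surjective _ m
  rw [ne_eq, CyclicModule.mk_eq_zero, weylIdeal, Submodule.mem_sInf] at hm0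
  push Not at hm0
  obtain ⟨J, hJ, hu⟩ := hm0
  have hJ' : IsIntegrableHighestWeight Z (CyclicModule J) (CyclicModule.gen J) :=
    ⟨hJ.1, CyclicModule.lieSpan_gen J, hJ.2⟩
  have hμJ : weightSpace H A (CyclicModule J) μ ≠ ⊥ := by
    intro hb
    rw [← CyclicModule.mk_eq_zero] at hu
    refine hu ((Submodule.mem_bot ℂ).mp (hb.le fun h => ?_))
    have h1 := mem_weightSpace.mp hm h
    rw [CyclicModule.lie_mk, ← CyclicModule.mk_smul, ← sub_eq_zero, ← map_sub,
      CyclicModule.mk_eq_zero] at h1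
    rw [CyclicModule.lie_mk, ← CyclicModule.mk_smul, ← sub_eq_zero, ← map_sub,
      CyclicModule.mk_eq_zero]
    exact sInf_le hJ h1
  exact ⟨hJ'.mem_weightBound hμJ, hJ.1.isIntegralWeight hμJ⟩

theorem isIntegrableHighestWeight_weylModule :
    IsIntegrableHighestWeight Z (WeylModule Z) (WeylModule.gen Z) :=
  ⟨isIntegrable_weylModule Z, CyclicModule.lieSpan_gen _, isHighestWeightVector_weylGen Z⟩

/-- The local Weyl module exists. -/
theorem isLocalWeylModule_weylModule :
    IsLocalWeylModule.{w} Z (WeylModule Z) (WeylModule.gen Z) :=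
  { isIntegrableHighestWeight_weylModule Z with
    maximal := fun N _ _ _ _ n hN => by
      have hle := weylIdeal_le_annIdeal_toEnd Z hN.integrable hN.highest
      exact ⟨CyclicModule.hom n hle,
        surjective_of_lieSpan_eq_top _ (CyclicModule.hom_gen n hle) hN.generated,
        CyclicModule.hom_gen n hle⟩ }

end Weyl

end LocalWeyl

namespace LocalWeyl

open LieAlgebra LieAlgebra.IsKilling LieModule

/-! ### Commutation formulas for `sl₂ ⊗ A` -/

section Words

variable {A : Type*} [CommRing A] [Algebra ℂ A] {L : Type*} [LieRing L] [LieAlgebra ℂ L]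
  {V : Type*} [AddCommGroup V] [Module ℂ V] [LieRingModule (A ⊗[ℂ] L) V]

/-- The vector `(a₁ ⊗ f) ⋯ (aₙ ⊗ f) v`. -/
def word (f : L) (v : V) (l : List A) : V := l.foldr (fun a u => ⁅a ⊗ₜ[ℂ] f, u⁆) v

omit [Module ℂ V] in
@[simp] theorem word_nil (f : L) (v : V) : word f v ([] : List A) = v := rfl

omit [Module ℂ V] in
@[simp] theorem word_cons (f : L) (v : V) (a : A) (l : List A) :
    word f v (a :: l) = ⁅a ⊗ₜ[ℂ] f, word f v l⁆ := rfl

variable [LieModule ℂ (A ⊗[ℂ] L) V] {e f h : L} {v : V} {J : Ideal A}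

omit [Module ℂ V] [LieModule ℂ (A ⊗[ℂ] L) V] in
theorem lie_multiset_sum (x : A ⊗[ℂ] L) (M : Multiset V) :
    ⁅x, M.sum⁆ = (M.map fun u => ⁅x, u⁆).sum := by
  induction M using Multiset.induction_on with
  | empty => simp
  | cons u M ih => simp [ih]

/-- The action of `c ⊗ h` on a word replaces in turn each letter `a` by `-2 a c`. -/
theorem exists_lie_h_word (hf : ⁅h, f⁆ = -(2 • f)) (hv : ∀ c ∈ J, ⁅c ⊗ₜ[ℂ] h, v⁆ = 0) (l : List A)
    {c : A} (hc : c ∈ J) : ∃ M : Multiset (List A), Multiset.card M = l.length ∧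
      (∀ l' ∈ M, l'.length = l.length ∧ l'.prod = l.prod * c) ∧
      ⁅c ⊗ₜ[ℂ] h, word f v l⁆ = (-2 : ℂ) • (M.map (word f v)).sum := by
  induction l with
  | nil => exact ⟨0, by simp, by simp, by simp [hv c hc]⟩
  | cons a l ih =>
    obtain ⟨M, hM, hM', hsum⟩ := ih
    refine ⟨(c * a :: l) ::ₘ M.map (a :: ·), by simp [hM], ?_, ?_⟩
    · intro l' hl'
      rw [Multiset.mem_cons, Multiset.mem_map] at hl'
      obtain rfl | ⟨l'', hl'', rfl⟩ := hl'
      · simp only [List.length_cons, List.prod_cons, true_and]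
        ring
      · simp only [List.length_cons, List.prod_cons, hM' l'' hl'', true_and]
        ring
    · have h2 : (c * a) ⊗ₜ[ℂ] (-(2 • f)) = (-2 : ℂ) • ((c * a) ⊗ₜ[ℂ] f) := by
        rw [← TensorProduct.tmul_smul, neg_smul, two_smul, two_smul]
      rw [word_cons, leibniz_lie, LieAlgebra.ExtendScalars.bracket_tmul, hf, h2, smul_lie, hsum,
        lie_smul, lie_multiset_sum, Multiset.map_map, Multiset.map_cons, Multiset.sum_cons,
        smul_add, Multiset.map_map]
      rfl

/-- The action of `c ⊗ e` on a word merges in turn each pair of letters `a`, `a'` to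
`-2 a a' c`. -/
theorem exists_lie_e_word (hef : ⁅e, f⁆ = h) (hf : ⁅h, f⁆ = -(2 • f))
    (hv : ∀ c ∈ J, ⁅c ⊗ₜ[ℂ] h, v⁆ = 0) (hv' : ∀ c : A, ⁅c ⊗ₜ[ℂ] e, v⁆ = 0) (l : List A)
    {c : A} (hc : c ∈ J) : ∃ M : Multiset (List A), Multiset.card M = l.length.choose 2 ∧
      (∀ l' ∈ M, l'.length + 1 = l.length ∧ l'.prod = l.prod * c) ∧
      ⁅c ⊗ₜ[ℂ] e, word f v l⁆ = (-2 : ℂ) • (M.map (word f v)).sum := by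
  induction l with
  | nil => exact ⟨0, by simp, by simp, by simp [hv' c]⟩
  | cons a l ih =>
    obtain ⟨M, hM, hM', hsum⟩ := ih
    obtain ⟨M₁, hM₁, hM₁', hsum₁⟩ := exists_lie_h_word hf hv l (J.mul_mem_right a hc)
    refine ⟨M₁ + M.map (a :: ·), ?_, ?_, ?_⟩
    -- Pascal's rule: a pair either contains the new letter, through the action of `ca ⊗ h` on the
    -- tail, or lies in the tail.
    · rw [Multiset.card_add, Multiset.card_map, hM, hM₁, List.length_cons,
        Nat.choose_succ_succ' _ 1, Nat.choose_one_right]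
    · intro l' hl'
      rw [Multiset.mem_add, Multiset.mem_map] at hl'
      obtain hl' | ⟨l'', hl'', rfl⟩ := hl'
      · simp only [List.length_cons, List.prod_cons, hM₁' l' hl', true_and]
        ring
      · simp only [List.length_cons, List.prod_cons, hM' l'' hl'', true_and]
        ring
    · rw [word_cons, leibniz_lie, LieAlgebra.ExtendScalars.bracket_tmul, hef, hsum₁, hsum,
        lie_smul, lie_multiset_sum, Multiset.map_map, Multiset.map_add, Multiset.sum_add,
        smul_add, Multiset.map_map]
      rfl

/-- If long words vanish, then a single letter from a power of `J` annihilates `v`. -/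
theorem exists_lie_words (hef : ⁅e, f⁆ = h) (hf : ⁅h, f⁆ = -(2 • f))
    (hv : ∀ c ∈ J, ⁅c ⊗ₜ[ℂ] h, v⁆ = 0) (hv' : ∀ c : A, ⁅c ⊗ₜ[ℂ] e, v⁆ = 0) (n : ℕ) :
    ∃ k : ℂ, k ≠ 0 ∧ ∀ s : List A, s.length = n → (∀ c ∈ s, c ∈ J) → ∀ l : List A,
      l.length = n + 1 →
      s.foldl (fun u c => ⁅c ⊗ₜ[ℂ] e, u⁆) (word f v l) = k • ⁅(l.prod * s.prod) ⊗ₜ[ℂ] f, v⁆ := by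
  induction n with
  | zero =>
    refine ⟨1, one_ne_zero, fun s hs _ l hl => ?_⟩
    obtain rfl := List.length_eq_zero_iff.mp hs
    obtain ⟨a, rfl⟩ := List.length_eq_one_iff.mp hl
    simp
  | succ n ih =>
    obtain ⟨k, hk, ih⟩ := ih
    -- The first `c ⊗ e` acts on a word of length `n + 2`, giving `(n + 2).choose 2` shorter words
    -- with factor `-2`. All of them have the same product of letters, so by induction they
    -- contribute equally.
    refine ⟨-2 * ((n + 2).choose 2 * k), ?_, fun s hs hsJ l hl => ?_⟩
    · have : (n + 2).choose 2 ≠ 0 := (Nat.choose_pos (by omega)).ne'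
      simp [hk, this]
    · obtain ⟨c, s, rfl⟩ := List.exists_cons_of_length_eq_add_one hs
      rw [List.length_cons, Nat.add_right_cancel_iff] at hs
      obtain ⟨M, hM, hM', hsum⟩ := exists_lie_e_word hef hf hv hv' l (hsJ c List.mem_cons_self)
      have hlin (t : List A) (M : Multiset V) :
          t.foldl (fun u c => ⁅c ⊗ₜ[ℂ] e, u⁆) ((-2 : ℂ) • M.sum) =
          (-2 : ℂ) • (M.map fun u => t.foldl (fun u c => ⁅c ⊗ₜ[ℂ] e, u⁆) u).sum := by
        induction t generalizing M with
        | nil => simp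
        | cons a t iht =>
          rw [List.foldl_cons, lie_smul, lie_multiset_sum, iht, Multiset.map_map]
          rfl
      rw [List.foldl_cons, hsum, hlin, Multiset.map_map, mul_smul, mul_smul]
      congr 1
      have hcongr : M.map ((fun u => s.foldl (fun u c => ⁅c ⊗ₜ[ℂ] e, u⁆) u) ∘ word f v) =
          M.map fun _ => k • ⁅(l.prod * (c :: s).prod) ⊗ₜ[ℂ] f, v⁆ := by
        refine Multiset.map_congr rfl fun l' hl' => ?_
        obtain ⟨h1, h2⟩ := hM' l' hl'
        rw [Function.comp_apply,
          ih s hs (fun c hc => hsJ c (List.mem_cons_of_mem _ hc)) l' (by omega), h2,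
          List.prod_cons, mul_assoc]
      rw [hcongr, Multiset.map_const', Multiset.sum_replicate, hM, hl, Nat.cast_smul_eq_nsmul]

omit [Algebra ℂ A] in
-- Elements of `J ^ n` are sums of products `a c₁ ⋯ cₙ` with all `cᵢ ∈ J`, exactly the coefficients
-- produced by `exists_lie_words`.
theorem mem_pow_induction {p : A → Prop} (add : ∀ x y, p x → p y → p (x + y)) {n : ℕ}
    (prod : ∀ a : A, ∀ s : List A, s.length = n → (∀ c ∈ s, c ∈ J) → p (a * s.prod))
    {x : A} (hx : x ∈ J ^ n) : p x := by
  induction n generalizing x p with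
  | zero => simpa using prod x [] rfl (by simp)
  | succ n ih =>
    rw [pow_succ] at hx
    refine Submodule.mul_induction_on hx (fun x hx y hy => ?_) fun x y => add x y
    refine ih (p := fun x => p (x * y)) (fun x x' h h' => ?_) (fun a s hs hsJ => ?_) hx
    · rw [add_mul]; exact add _ _ h h'
    · have := prod a (y :: s) (by simp [hs]) (by simpa using ⟨hy, hsJ⟩)
      rwa [List.prod_cons, mul_comm y, ← mul_assoc] at this

theorem lie_eq_zero_of_word_eq_zero (hef : ⁅e, f⁆ = h) (hf : ⁅h, f⁆ = -(2 • f))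
    (hv : ∀ c ∈ J, ⁅c ⊗ₜ[ℂ] h, v⁆ = 0) (hv' : ∀ c : A, ⁅c ⊗ₜ[ℂ] e, v⁆ = 0) {n : ℕ}
    (hn : ∀ l : List A, l.length = n + 1 → word f v l = 0) {a : A} (ha : a ∈ J ^ n) :
    ⁅a ⊗ₜ[ℂ] f, v⁆ = 0 := by
  obtain ⟨k, hk, hkey⟩ := exists_lie_words hef hf hv hv' n
  refine mem_pow_induction (p := fun a => ⁅a ⊗ₜ[ℂ] f, v⁆ = 0) (fun x y hx hy => ?_)
    (fun a s hs hsJ => ?_) ha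
  · rw [TensorProduct.add_tmul, add_lie, hx, hy, add_zero]
  -- The word with letters `a, 1, …, 1` vanishes by assumption. Applying `n` raising operators
  -- collapses it to a nonzero multiple of the desired vector.
  · have hl : (a :: List.replicate n 1).length = n + 1 := by simp
    have h1 := hkey s hs hsJ _ hl
    have h0 (t : List A) : t.foldl (fun u c => ⁅c ⊗ₜ[ℂ] e, u⁆) (0 : V) = 0 := by
      induction t with
      | nil => rfl
      | cons c t ih => rw [List.foldl_cons, lie_zero, ih]
    rw [hn _ hl, h0, List.prod_cons, List.prod_replicate, one_pow, mul_one] at h1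
    exact (smul_eq_zero.mp h1.symm).resolve_left hk

end Words

/-! ### Annihilation by a power of the vanishing ideal -/

section Annihilation

variable {L : Type*} [LieRing L] [LieAlgebra ℂ L] [FiniteDimensional ℂ L]
  [LieAlgebra.IsSemisimple ℂ L]
  {H : LieSubalgebra ℂ L} [H.IsCartanSubalgebra]
  {b : (rootSystem H).Base} {A : Type*} [CommRing A] [Algebra ℂ A]
  {lam : Module.Dual ℂ H} {Z : LambdaMultiset b A lam}

variable (Z) in
/-- The ideal of functions vanishing at all points of the multiset. -/
def LambdaMultiset.vanishingIdeal : Ideal A :=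
  ⨅ i, ⨅ z ∈ Z.points i, RingHom.ker (z : A →+* ℂ)

theorem LambdaMultiset.mem_vanishingIdeal {a : A} :
    a ∈ Z.vanishingIdeal ↔ ∀ i, ∀ z ∈ Z.points i, z a = 0 := by
  simp [vanishingIdeal, Submodule.mem_iInf, RingHom.mem_ker]

variable {V : Type*} [AddCommGroup V] [Module ℂ V] [LieRingModule (A ⊗[ℂ] L) V]
  [LieModule ℂ (A ⊗[ℂ] L) V] {v : V}

theorem IsHighestWeightVector.cartan_lie_eq_zero (hv : IsHighestWeightVector Z v) (h : H) {a : A}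
    (ha : a ∈ Z.vanishingIdeal) : ⁅a ⊗ₜ[ℂ] (h : L), v⁆ = 0 := by
  have hh : h ∈ Submodule.span ℂ (Set.range (simpleCoroot b)) := by
    rw [span_simpleCoroot]; trivial
  induction hh using Submodule.span_induction with
  | zero => simp
  | mem x hx =>
    obtain ⟨i, rfl⟩ := hx
    rw [hv.coroot_lie, Multiset.map_congr rfl (LambdaMultiset.mem_vanishingIdeal.mp ha i)]
    simp
  | add x y _ _ hx hy => rw [AddMemClass.coe_add, TensorProduct.tmul_add, add_lie, hx, hy, add_zero]
  | smul c x _ hx => rw [SetLike.val_smul, TensorProduct.tmul_smul, smul_lie, hx, smul_zero]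

theorem word_mem_weightSpace {χ μ : Module.Dual ℂ H} {f : L} (hf : f ∈ rootSpace H χ)
    (hv : v ∈ weightSpace H A V μ) (l : List A) :
    word f v l ∈ weightSpace H A V (μ + l.length • χ) := by
  induction l with
  | nil => simpa using hv
  | cons a l ih =>
    rw [List.length_cons, succ_nsmul, ← add_assoc]
    exact lie_mem_weightSpace hf ih a

/-- Finiteness of the weights kills all words of some length `n + 1` in the negative root vector.
The raising argument then gives the claim for that vector, and its root space is a line. -/
theorem IsIntegrableHighestWeight.exists_pow_neg_lie (hV : IsIntegrableHighestWeight Z V v)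
    {α : H.root} (hα : b.IsPos α) : ∃ n, ∀ a ∈ Z.vanishingIdeal ^ n,
      ∀ y ∈ rootSpace H ⇑(-(α : Weight ℂ H L).toLinear), ⁅a ⊗ₜ[ℂ] y, v⁆ = 0 := by
  have hα0 : (α : Weight ℂ H L).IsNonZero := (Finset.mem_filter.mp α.2).2
  obtain ⟨D, -, hD⟩ := hV.integrable
  obtain ⟨n, hn⟩ : ∃ n : ℕ,
      weightSpace H A V (lam + (n + 1) • (-(α : Weight ℂ H L).toLinear)) = ⊥ := by
    by_contra! hne
    refine Set.infinite_of_injective_forall_mem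
      ((add_nsmul_toLinear_injective hα0.neg lam).comp (add_left_injective 1))
      (fun n => ?_) D.finite_toSet
    exact (iSupIndep_weightSpace H A V).mem_of_ne_bot hD (hne n)
  obtain ⟨h, e, f, ht, he, hf⟩ := exists_isSl2Triple_of_weight_isNonZero hα0
  have hh := ht.h_eq_coroot hα0 he hf
  have hf' := mem_rootSpace_neg_toLinear.mpr hf
  have key (a : A) (ha : a ∈ Z.vanishingIdeal ^ n) : ⁅a ⊗ₜ[ℂ] f, v⁆ = 0 := by
    refine lie_eq_zero_of_word_eq_zero ht.lie_e_f ht.lie_h_f_nsmul (fun c hc => ?_)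
      (fun c => hV.highest.nPlus_lie e (rootSpace_le_nPlus b hα he) c) (fun l hl => ?_) ha
    · rw [hh]
      exact hV.highest.cartan_lie_eq_zero _ hc
    · have := word_mem_weightSpace hf' hV.highest.mem_weightSpace l
      rw [hl] at this
      exact (Submodule.mem_bot ℂ).mp (hn.le this)
  refine ⟨n, fun a ha y hy => ?_⟩
  have hfin := finrank_rootSpace_eq_one (-(α : Weight ℂ H L)) hα0.neg
  obtain ⟨c, hc⟩ := exists_smul_eq_of_finrank_eq_one hfin (x := ⟨f, hf⟩)
    (by simpa [Subtype.ext_iff] using ht.f_ne_zero) ⟨y, hy⟩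
  have hc' : c • f = y := congrArg Subtype.val hc
  rw [← hc', TensorProduct.tmul_smul, smul_lie, key a ha, smul_zero]

/-- An integrable highest weight module is annihilated by `𝔤 ⊗ I`, where `I` is some power of the
vanishing ideal of the points. -/
theorem IsIntegrableHighestWeight.exists_pow_smul_lie (hV : IsIntegrableHighestWeight Z V v) :
    ∃ n, ∀ a ∈ Z.vanishingIdeal ^ n, ∀ (x : A ⊗[ℂ] L) (u : V), ⁅a • x, u⁆ = 0 := by
  have hex (α : H.root) : ∃ n, b.IsPos α → ∀ a ∈ Z.vanishingIdeal ^ n,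
      ∀ y ∈ rootSpace H ⇑(-(α : Weight ℂ H L).toLinear), ⁅a ⊗ₜ[ℂ] y, v⁆ = 0 := by
    by_cases hα : b.IsPos α
    · obtain ⟨n, hn⟩ := hV.exists_pow_neg_lie hα
      exact ⟨n, fun _ => hn⟩
    · exact ⟨0, fun h => absurd h hα⟩
  choose n hn using hex
  -- The sum dominates every `n α`. The extra `1` ensures `I ^ N ≤ I`, which the Cartan part needs.
  let N := ∑ α, n α + 1
  have hgen (a : A) (ha : a ∈ Z.vanishingIdeal ^ N) (x : L) : ⁅a ⊗ₜ[ℂ] x, v⁆ = 0 := by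
    induction x using triangular_induction b with
    | zero => simp
    | add x y hx hy => rw [TensorProduct.tmul_add, add_lie, hx, hy, add_zero]
    | cartan h =>
      exact hV.highest.cartan_lie_eq_zero h (Ideal.pow_le_self (by omega) ha)
    | pos α hα x hx => exact hV.highest.nPlus_lie x (rootSpace_le_nPlus b hα hx) a
    | neg α hα x hx =>
      refine hn α hα a (Ideal.pow_le_pow_right ?_ ha) x hx
      exact (Finset.single_le_sum (fun _ _ => Nat.zero_le _) (Finset.mem_univ α)).trans
        (Nat.le_succ _)
  refine ⟨N, fun a ha x u => ?_⟩
  -- The vectors killed by all `a • x` form a submodule because `⁅a • x, y⁆ = a • ⁅x, y⁆`. It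
  -- therefore suffices to treat the generator.
  let U : LieSubmodule ℂ (A ⊗[ℂ] L) V :=
    { carrier := {u | ∀ x : A ⊗[ℂ] L, ⁅a • x, u⁆ = 0}
      add_mem' := fun {u w} hu hw x => by rw [lie_add, hu x, hw x, add_zero]
      zero_mem' := fun x => lie_zero _
      smul_mem' := fun c u hu x => by rw [lie_smul, hu x, smul_zero]
      lie_mem := fun {y u} hu x => by
        rw [leibniz_lie, smul_lie, hu, hu, lie_zero, add_zero] }
  have hU : U = ⊤ := by
    rw [eq_top_iff, ← hV.generated, LieSubmodule.lieSpan_le, Set.singleton_subset_iff]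
    intro x
    induction x with
    | zero => simp
    | add x y hx hy => rw [smul_add, add_lie, hx, hy, add_zero]
    | tmul q x =>
      rw [TensorProduct.smul_tmul', smul_eq_mul]
      exact hgen _ (Ideal.mul_mem_right q _ ha) x
  have hu : u ∈ U := by rw [hU]; trivial
  exact hu x

end Annihilation

end LocalWeyl

namespace LocalWeyl

open LieAlgebra LieAlgebra.IsKilling LieModule

attribute [local instance 100] LieRing.ofAssociativeRing

/-! ### Commuting representations and maps out of tensor products -/

section Pairing

variable {K : Type*} [LieRing K] [LieAlgebra ℂ K] {V : Type*} [AddCommGroup V] [Module ℂ V]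
  {ρ σ : K →ₗ⁅ℂ⁆ Module.End ℂ V}

/-- Commutation passes to the enveloping algebras one side at a time: each operator of one
representation is an intertwiner for the other. -/
theorem envHom_comm (hρσ : ∀ x y u, ρ x (σ y u) = σ y (ρ x u))
    (a c : UniversalEnvelopingAlgebra ℂ K) (u : V) :
    envHom ρ a (envHom σ c u) = envHom σ c (envHom ρ a u) :=
  envHom_commute σ (f := envHom ρ a) (fun y w =>
    (envHom_commute ρ (f := σ y) (fun x w' => (hρσ x y w').symm) a w).symm) c u

/-- Two commuting representations adding up to the given one yield a homomorphism from a tensor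
product of cyclic modules. -/
theorem exists_hom_tensorProduct [LieRingModule K V] [LieModule ℂ K V]
    (hρσ : ∀ x y u, ρ x (σ y u) = σ y (ρ x u)) (hadd : ∀ (x : K) (u : V), ρ x u + σ x u = ⁅x, u⁆)
    {v : V} {I J : LeftIdeal K} (hI : I ≤ annIdeal ρ v) (hJ : J ≤ annIdeal σ v) :
    ∃ f : CyclicModule I ⊗[ℂ] CyclicModule J →ₗ⁅ℂ, K⁆ V,
      f (CyclicModule.gen I ⊗ₜ CyclicModule.gen J) = v := by
  let φ : CyclicModule J →ₗ[ℂ] V :=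
    CyclicModule.lift ((LinearMap.applyₗ v).comp (envHom σ).toLinearMap) fun _ hu => hJ hu
  have hφ (u) : φ (CyclicModule.mk J u) = envHom σ u v := rfl
  let β : CyclicModule I →ₗ[ℂ] CyclicModule J →ₗ[ℂ] V :=
    CyclicModule.lift ((LinearMap.lcomp ℂ V φ).comp (envHom ρ).toLinearMap) fun a ha => by
      ext m
      obtain ⟨c, rfl⟩ := CyclicModule.mk_surjective J m
      change envHom ρ a (φ (CyclicModule.mk J c)) = 0
      rw [hφ, envHom_comm hρσ, (mem_annIdeal ρ).mp (hI ha), map_zero]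
  have hβ (a c) : β (CyclicModule.mk I a) (CyclicModule.mk J c) = envHom ρ a (envHom σ c v) := rfl
  refine ⟨{ TensorProduct.lift β with map_lie' := fun {x t} => ?_ }, ?_⟩
  · change TensorProduct.lift β ⁅x, t⁆ = ⁅x, TensorProduct.lift β t⁆
    induction t with
    | zero => simp
    | add s t hs ht => rw [lie_add, map_add, map_add, lie_add, hs, ht]
    | tmul m m' =>
      obtain ⟨a, rfl⟩ := CyclicModule.mk_surjective I m
      obtain ⟨c, rfl⟩ := CyclicModule.mk_surjective J m'
      rw [TensorProduct.LieModule.lie_tmul_right, map_add, TensorProduct.lift.tmul,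
        TensorProduct.lift.tmul, TensorProduct.lift.tmul, CyclicModule.lie_mk,
        CyclicModule.lie_mk, hβ, hβ, hβ, map_mul, map_mul, Module.End.mul_apply,
        Module.End.mul_apply, envHom_ι, envHom_ι, ← hadd]
      congr 1
      exact envHom_commute ρ (f := σ x) (fun y w' => (hρσ y x w').symm) a _ |>.symm
  · change TensorProduct.lift β (CyclicModule.gen I ⊗ₜ CyclicModule.gen J) = v
    rw [TensorProduct.lift.tmul, ← CyclicModule.mk_one, ← CyclicModule.mk_one, hβ, map_one,
      map_one]
    rfl

end Pairing

/-! ### Splitting the action by `s + t = 1` -/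

section Twist

variable {A : Type*} [CommRing A] [Algebra ℂ A] {L : Type*} [LieRing L] [LieAlgebra ℂ L]
  {V : Type*} [AddCommGroup V] [Module ℂ V] [LieRingModule (A ⊗[ℂ] L) V]
  [LieModule ℂ (A ⊗[ℂ] L) V]

/-- The representation `x ↦ t x`, where `t ∈ A` is idempotent modulo the annihilator. -/
def twist (t : A) (ht : ∀ (x : A ⊗[ℂ] L) (u : V), ⁅(t * t) • x, u⁆ = ⁅t • x, u⁆) :
    A ⊗[ℂ] L →ₗ⁅ℂ⁆ Module.End ℂ V where
  toFun x := toEnd ℂ (A ⊗[ℂ] L) V (t • x)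
  map_add' x y := by rw [smul_add, map_add]
  map_smul' c x := by rw [smul_comm, map_smul, RingHom.id_apply]
  map_lie' {x y} := by
    change _ = ⁅toEnd ℂ (A ⊗[ℂ] L) V (t • x), toEnd ℂ (A ⊗[ℂ] L) V (t • y)⁆
    rw [← LieHom.map_lie, smul_lie, lie_smul, smul_smul]
    ext u
    exact (ht _ u).symm

theorem twist_apply (t : A) (ht : ∀ (x : A ⊗[ℂ] L) (u : V), ⁅(t * t) • x, u⁆ = ⁅t • x, u⁆)
    (x : A ⊗[ℂ] L) (u : V) : twist t ht x u = ⁅t • x, u⁆ := rfl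

variable {V' : Type*} [AddCommGroup V'] [Module ℂ V'] [LieRingModule (A ⊗[ℂ] L) V']
  [LieModule ℂ (A ⊗[ℂ] L) V']

/-- If `s + t = 1`, where `𝔤 ⊗ s` annihilates the first and `𝔤 ⊗ t` the second factor, then the
tensor product of generators is a generator. -/
theorem lieSpan_tmul_eq_top {v : V} {v' : V'} {s t : A} (hst : s + t = 1)
    (hs : ∀ (x : A ⊗[ℂ] L) (u : V), ⁅s • x, u⁆ = 0)
    (ht : ∀ (x : A ⊗[ℂ] L) (u : V'), ⁅t • x, u⁆ = 0)
    (hv : LieSubmodule.lieSpan ℂ (A ⊗[ℂ] L) {v} = ⊤)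
    (hv' : LieSubmodule.lieSpan ℂ (A ⊗[ℂ] L) {v'} = ⊤) :
    LieSubmodule.lieSpan ℂ (A ⊗[ℂ] L) {v ⊗ₜ[ℂ] v'} = ⊤ := by
  set N := LieSubmodule.lieSpan ℂ (A ⊗[ℂ] L) {v ⊗ₜ[ℂ] v'} with hN
  have hdec (x : A ⊗[ℂ] L) : x = s • x + t • x := by rw [← add_smul, hst, one_smul]
  -- On the first factor `t • x` acts as `x`, and on the second as zero. Thus `N` is stable under
  -- each tensor factor separately.
  have hl (x : A ⊗[ℂ] L) (u : V) (u' : V') (h : u ⊗ₜ[ℂ] u' ∈ N) : ⁅x, u⁆ ⊗ₜ[ℂ] u' ∈ N := by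
    have := N.lie_mem (x := t • x) h
    rwa [TensorProduct.LieModule.lie_tmul_right, ht, TensorProduct.tmul_zero, add_zero,
      ← zero_add ⁅t • x, u⁆, ← hs x u, ← add_lie, ← hdec] at this
  have hr (x : A ⊗[ℂ] L) (u : V) (u' : V') (h : u ⊗ₜ[ℂ] u' ∈ N) : u ⊗ₜ[ℂ] ⁅x, u'⁆ ∈ N := by
    have := N.lie_mem (x := s • x) h
    rwa [TensorProduct.LieModule.lie_tmul_right, hs, TensorProduct.zero_tmul, zero_add,
      ← add_zero ⁅s • x, u'⁆, ← ht x u', ← add_lie, ← hdec] at this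
  let N₁ : LieSubmodule ℂ (A ⊗[ℂ] L) V :=
    { N.toSubmodule.comap ((TensorProduct.mk ℂ V V').flip v') with
      lie_mem := fun {x u} hu => hl x u v' hu }
  have h₁ : N₁ = ⊤ := by
    rw [eq_top_iff, ← hv, LieSubmodule.lieSpan_le, Set.singleton_subset_iff]
    exact LieSubmodule.subset_lieSpan (Set.mem_singleton _)
  have h₁' (u : V) : u ⊗ₜ[ℂ] v' ∈ N := by
    have : u ∈ N₁ := by rw [h₁]; trivial
    exact this
  have h₂ (u : V) (u' : V') : u ⊗ₜ[ℂ] u' ∈ N := by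
    let N₂ : LieSubmodule ℂ (A ⊗[ℂ] L) V' :=
      { N.toSubmodule.comap (TensorProduct.mk ℂ V V' u) with
        lie_mem := fun {x u'} hu => hr x u u' hu }
    have h : N₂ = ⊤ := by
      rw [eq_top_iff, ← hv', LieSubmodule.lieSpan_le, Set.singleton_subset_iff]
      exact h₁' u
    have : u' ∈ N₂ := by rw [h]; trivial
    exact this
  rw [eq_top_iff]
  intro y _
  induction y with
  | zero => exact zero_mem N
  | add x y hx hy => exact add_mem (hx trivial) (hy trivial)
  | tmul u u' => exact h₂ u u'

end Twist

/-! ### The tensor product theorem -/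

section Main

variable {L : Type*} [LieRing L] [LieAlgebra ℂ L] [FiniteDimensional ℂ L]
  [LieAlgebra.IsSemisimple ℂ L]
  {H : LieSubalgebra ℂ L} [H.IsCartanSubalgebra]
  {b : (rootSystem H).Base} {A : Type*} [CommRing A] [Algebra ℂ A]
  {lam lam' : Module.Dual ℂ H} {Z : LambdaMultiset b A lam} {Z' : LambdaMultiset b A lam'}

theorem LambdaMultiset.points_union (i : b.support) :
    (Z.union Z').points i = Z.points i + Z'.points i := rfl

section Tensor

variable {V : Type*} [AddCommGroup V] [Module ℂ V] [LieRingModule (A ⊗[ℂ] L) V]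
  [LieModule ℂ (A ⊗[ℂ] L) V]
  {V' : Type*} [AddCommGroup V'] [Module ℂ V'] [LieRingModule (A ⊗[ℂ] L) V']
  [LieModule ℂ (A ⊗[ℂ] L) V'] {v : V} {v' : V'}

theorem IsHighestWeightVector.tmul (hv : IsHighestWeightVector Z v)
    (hv' : IsHighestWeightVector Z' v') : IsHighestWeightVector (Z.union Z') (v ⊗ₜ[ℂ] v') := by
  refine ⟨fun x hx P => ?_, fun i P => ?_⟩
  · rw [TensorProduct.LieModule.lie_tmul_right, hv.nPlus_lie x hx, hv'.nPlus_lie x hx,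
      TensorProduct.zero_tmul, TensorProduct.tmul_zero, add_zero]
  · rw [TensorProduct.LieModule.lie_tmul_right, hv.coroot_lie, hv'.coroot_lie,
      TensorProduct.tmul_smul, ← TensorProduct.smul_tmul', ← add_smul, LambdaMultiset.union,
      Multiset.map_add, Multiset.sum_add]

theorem IsIntegrable.tensorProduct (hV : IsIntegrable H A V) (hV' : IsIntegrable H A V') :
    IsIntegrable H A (V ⊗[ℂ] V') := by
  classical
  obtain ⟨D, hD, hDV⟩ := hV
  obtain ⟨D', hD', hDV'⟩ := hV'
  refine ⟨Finset.image₂ (· + ·) D D', fun μ hμ => ?_, ?_⟩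
  · obtain ⟨ν, hν, ν', hν', rfl⟩ := Finset.mem_image₂.mp hμ
    exact (hD ν hν).add (hD' ν' hν')
  · rw [eq_top_iff]
    rintro y -
    induction y with
    | zero => exact zero_mem _
    | add x y hx hy => exact add_mem hx hy
    | tmul u u' =>
      have hu : u ∈ (⊤ : Submodule ℂ V) := trivial
      rw [← hDV, iSup_subtype'] at hu
      have hu' : u' ∈ (⊤ : Submodule ℂ V') := trivial
      rw [← hDV', iSup_subtype'] at hu'
      induction hu using Submodule.iSup_induction' with
      | zero => rw [TensorProduct.zero_tmul]; exact zero_mem _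
      | add x y _ _ hx hy => rw [TensorProduct.add_tmul]; exact add_mem hx hy
      | mem μ u hu =>
        induction hu' using Submodule.iSup_induction' with
        | zero => rw [TensorProduct.tmul_zero]; exact zero_mem _
        | add x y _ _ hx hy => rw [TensorProduct.tmul_add]; exact add_mem hx hy
        | mem μ' u' hu' =>
          refine Submodule.mem_iSup_of_mem ((μ : Module.Dual ℂ H) + μ') (Submodule.mem_iSup_of_mem
            (Finset.mem_image₂_of_mem μ.2 μ'.2) fun h => ?_)
          rw [TensorProduct.LieModule.lie_tmul_right, hu h, hu' h, TensorProduct.tmul_smul,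
            ← TensorProduct.smul_tmul', ← add_smul, LinearMap.add_apply]

end Tensor

/-- Coprimality passes to finite intersections, which reduces the claim to two distinct points.
There, a function `a` separating them yields the two normalised differences `z' a - a` and `a - z
a`, whose sum is `1`. -/
theorem isCoprime_vanishingIdeal (hZ : ∀ i i', ∀ z ∈ Z.points i, ∀ z' ∈ Z'.points i', z ≠ z') :
    IsCoprime Z.vanishingIdeal Z'.vanishingIdeal := by
  classical
  have hiInf {b' : (rootSystem H).Base} {μ : Module.Dual ℂ H} (Y : LambdaMultiset b' A μ)
      (I : Ideal A) (hI : ∀ i, ∀ z ∈ Y.points i, IsCoprime I (RingHom.ker (z : A →+* ℂ))) :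
      IsCoprime I Y.vanishingIdeal := by
    have : Y.vanishingIdeal = ⨅ i ∈ (Finset.univ : Finset b'.support),
        ⨅ z ∈ (Y.points i).toFinset, RingHom.ker (z : A →+* ℂ) := by
      simp [LambdaMultiset.vanishingIdeal]
    rw [this]
    exact Ideal.isCoprime_biInf fun i _ => Ideal.isCoprime_biInf fun z hz =>
      hI i z (Multiset.mem_toFinset.mp hz)
  refine hiInf Z' _ fun i' z' hz' => (hiInf Z _ fun i z hz => ?_).symm
  obtain ⟨a, ha⟩ := DFunLike.ne_iff.mp (hZ i i' z hz z' hz')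
  rw [Ideal.isCoprime_iff_exists]
  have hd : z' a - z a ≠ 0 := sub_ne_zero.mpr (Ne.symm ha)
  refine ⟨algebraMap ℂ A (z' a - z a)⁻¹ * (algebraMap ℂ A (z' a) - a), ?_,
    algebraMap ℂ A (z' a - z a)⁻¹ * (a - algebraMap ℂ A (z a)), ?_, ?_⟩
  · simp [RingHom.mem_ker]
  · simp [RingHom.mem_ker]
  · rw [← mul_add, sub_add_sub_cancel, ← map_sub, ← map_mul, inv_mul_cancel₀ hd, map_one]

/-- A highest weight vector for one of two commuting representations adding up to an integrable
one is annihilated by the defining ideal of the local Weyl module. -/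
theorem weylIdeal_le_annIdeal_of_add {V : Type*} [AddCommGroup V] [Module ℂ V]
    [LieRingModule (A ⊗[ℂ] L) V] [LieModule ℂ (A ⊗[ℂ] L) V] (hV : IsIntegrable H A V)
    {ρ σ : A ⊗[ℂ] L →ₗ⁅ℂ⁆ Module.End ℂ V} (hρσ : ∀ x y u, ρ x (σ y u) = σ y (ρ x u))
    (hadd : ∀ (x : A ⊗[ℂ] L) (u : V), ρ x u + σ x u = ⁅x, u⁆) {v : V}
    (hn : ∀ x ∈ nPlus b, ∀ P : A, ρ (P ⊗ₜ[ℂ] x) v = 0)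
    (hc : ∀ (i : b.support) (P : A),
      ρ (P ⊗ₜ[ℂ] (simpleCoroot b i : L)) v = ((Z.points i).map fun z => z P).sum • v)
    (hn' : ∀ x ∈ nPlus b, ∀ P : A, σ (P ⊗ₜ[ℂ] x) v = 0)
    (hc' : ∀ (i : b.support) (P : A),
      σ (P ⊗ₜ[ℂ] (simpleCoroot b i : L)) v = ((Z'.points i).map fun z => z P).sum • v) :
    weylIdeal Z ≤ annIdeal ρ v := by
  classical
  have hσ (h : H) : σ ((1 : A) ⊗ₜ[ℂ] (h : L)) v = lam' h • v := by
    have := congrArg (orbitMap σ v)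
      ((isHighestWeightVector_annIdeal_gen hn' hc').mem_weightSpace h)
    rwa [orbitMap_lie, map_smul, orbitMap_gen] at this
  obtain ⟨D, hD, hDV⟩ := hV
  refine weylIdeal_le_annIdeal Z ρ hn hc (D := D.image (· - lam')) fun μ w hw hw0 hμ => ?_
  obtain ⟨m, rfl⟩ := hw
  obtain ⟨a, rfl⟩ := CyclicModule.mk_surjective _ m
  rw [orbitMap_mk] at hw0 hμ
  -- The Cartan part of `σ` acts on `v` by `lam'` and commutes with `ρ`, so it acts by `lam'` on the
  -- whole `ρ`-orbit. The `ρ`-weights are thus weights of `V` shifted by `-lam'`, hence finite in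
  -- number and integral.
  have hmem : envHom ρ a v ∈ weightSpace H A V (μ + lam') := by
    intro h
    have h1 := envHom_commute ρ (f := σ ((1 : A) ⊗ₜ[ℂ] (h : L)))
      (fun y w' => (hρσ y _ w').symm) a v
    rw [← hadd, hμ, h1, hσ, map_smul, ← add_smul, LinearMap.add_apply]
  have hne : weightSpace H A V (μ + lam') ≠ ⊥ := fun hb =>
    hw0 ((Submodule.mem_bot ℂ).mp (hb.le hmem))
  have hμD := (iSupIndep_weightSpace H A V).mem_of_ne_bot hDV hne
  refine ⟨Finset.mem_image.mpr ⟨_, hμD, add_sub_cancel_right _ _⟩, ?_⟩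
  have := (hD _ hμD).add Z'.isIntegralWeight.neg
  rwa [add_neg_cancel_right] at this

variable (Z Z') in
theorem exists_comaximal
    (hZ : ∀ i i', ∀ z ∈ Z.points i, ∀ z' ∈ Z'.points i', z ≠ z') :
    ∃ s t : A, s + t = 1 ∧ s ∈ Z.vanishingIdeal ∧ t ∈ Z'.vanishingIdeal ∧
      (∀ (x : A ⊗[ℂ] L) (u : WeylModule Z), ⁅s • x, u⁆ = 0) ∧
      (∀ (x : A ⊗[ℂ] L) (u : WeylModule Z'), ⁅t • x, u⁆ = 0) ∧
      ∀ (x : A ⊗[ℂ] L) (u : WeylModule (Z.union Z')), ⁅(s * t) • x, u⁆ = 0 := by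
  obtain ⟨n, hn⟩ := (isIntegrableHighestWeight_weylModule Z).exists_pow_smul_lie
  obtain ⟨n', hn'⟩ := (isIntegrableHighestWeight_weylModule Z').exists_pow_smul_lie
  obtain ⟨k, hk⟩ := (isIntegrableHighestWeight_weylModule (Z.union Z')).exists_pow_smul_lie
  -- One exponent is large enough for all three modules. The extra `1` makes `s` and `t` vanish at
  -- the points themselves.
  have hcop := (isCoprime_vanishingIdeal hZ).pow (m := n + n' + k + 1) (n := n + n' + k + 1)
  obtain ⟨s, hs, t, ht, hst⟩ := Ideal.isCoprime_iff_exists.mp hcop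
  refine ⟨s, t, hst, Ideal.pow_le_self (by omega) hs, Ideal.pow_le_self (by omega) ht,
    hn s (Ideal.pow_le_pow_right (by omega) hs), hn' t (Ideal.pow_le_pow_right (by omega) ht),
    hk (s * t) ?_⟩
  have hle : Z.vanishingIdeal * Z'.vanishingIdeal ≤ (Z.union Z').vanishingIdeal := by
    refine Ideal.mul_le_inf.trans fun a ha => ?_
    rw [LambdaMultiset.mem_vanishingIdeal]
    intro i z hz
    rcases Multiset.mem_add.mp hz with hz | hz
    · exact LambdaMultiset.mem_vanishingIdeal.mp ha.1 i z hz
    · exact LambdaMultiset.mem_vanishingIdeal.mp ha.2 i z hz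
  refine Ideal.pow_le_pow_right (show k ≤ n + n' + k + 1 by omega)
    (Ideal.pow_right_mono hle _ ?_)
  rw [mul_pow]
  exact Ideal.mul_mem_mul hs ht

/-- The splitting of the highest weight functional under multiplication by an element that is
`1` on the first multiset and `0` on the second. -/
theorem sum_map_add_mul {s t : A} (hst : s + t = 1) (hs : s ∈ Z.vanishingIdeal)
    (ht : t ∈ Z'.vanishingIdeal) (i : b.support) (P : A) :
    ((Z.points i + Z'.points i).map fun z => z (t * P)).sum =
      ((Z.points i).map fun z => z P).sum := by
  rw [Multiset.map_add, Multiset.sum_add]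
  have h1 : (Z.points i).map (fun z => z (t * P)) = (Z.points i).map fun z => z P := by
    refine Multiset.map_congr rfl fun z hz => ?_
    have h := congrArg z hst
    rw [map_add, LambdaMultiset.mem_vanishingIdeal.mp hs i z hz, zero_add, map_one] at h
    rw [map_mul, h, one_mul]
  have h2 : (Z'.points i).map (fun z => z (t * P)) = (Z'.points i).map fun _ => 0 := by
    refine Multiset.map_congr rfl fun z hz => ?_
    rw [map_mul, LambdaMultiset.mem_vanishingIdeal.mp ht i z hz, zero_mul]
  rw [h1, h2, Multiset.map_const', Multiset.sum_replicate, smul_zero, add_zero]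

-- Modulo `st`, which acts by zero, `s` and `t` are orthogonal idempotents. This makes both twists
-- representations and makes them commute. Since `t` is `1` at the points of `Z` and `0` at those of
-- `Z'`, the `t`-twist sees only `Z`, and the `s`-twist only `Z'`.
variable (Z Z') in
theorem nonempty_weylModule_union_equiv
    (hZ : ∀ i i', ∀ z ∈ Z.points i, ∀ z' ∈ Z'.points i', z ≠ z') :
    Nonempty (WeylModule (Z.union Z') ≃ₗ⁅ℂ, A ⊗[ℂ] L⁆ WeylModule Z ⊗[ℂ] WeylModule Z') := by
  obtain ⟨s, t, hst, hsZ, htZ', hs, ht, hkill⟩ := exists_comaximal Z Z' hZ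
  have hW := isIntegrableHighestWeight_weylModule Z
  have hW' := isIntegrableHighestWeight_weylModule Z'
  have hV := isIntegrableHighestWeight_weylModule (Z.union Z')
  have hgen := lieSpan_tmul_eq_top hst hs ht hW.generated hW'.generated
  have hle := weylIdeal_le_annIdeal_toEnd (Z.union Z')
    (hW.integrable.tensorProduct hW'.integrable) (hW.highest.tmul hW'.highest)
  have hss (x : A ⊗[ℂ] L) (u : WeylModule (Z.union Z')) : ⁅(s * s) • x, u⁆ = ⁅s • x, u⁆ := by
    have h : s * s = s - s * t := by rw [← mul_one_sub, ← hst, add_sub_cancel_right]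
    rw [h, sub_smul, sub_lie, hkill, sub_zero]
  have htt (x : A ⊗[ℂ] L) (u : WeylModule (Z.union Z')) : ⁅(t * t) • x, u⁆ = ⁅t • x, u⁆ := by
    have h : t * t = t - s * t := by rw [← one_sub_mul, ← hst, add_sub_cancel_left]
    rw [h, sub_smul, sub_lie, hkill, sub_zero]
  have hcomm (x y : A ⊗[ℂ] L) (u : WeylModule (Z.union Z')) :
      twist t htt x (twist s hss y u) = twist s hss y (twist t htt x u) := by
    rw [twist_apply, twist_apply, twist_apply, twist_apply, leibniz_lie, smul_lie, lie_smul,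
      smul_smul, mul_comm t s, hkill, zero_add]
  have hadd (x : A ⊗[ℂ] L) (u : WeylModule (Z.union Z')) :
      twist t htt x u + twist s hss x u = ⁅x, u⁆ := by
    rw [twist_apply, twist_apply, ← add_lie, ← add_smul, add_comm t, hst, one_smul]
  have hnt (r : A) (x : L) (hx : x ∈ nPlus b) (P : A) :
      ⁅r • (P ⊗ₜ[ℂ] x), WeylModule.gen (Z.union Z')⁆ = 0 := by
    rw [TensorProduct.smul_tmul', hV.highest.nPlus_lie x hx]
  have hct (i : b.support) (P : A) :
      ⁅t • (P ⊗ₜ[ℂ] (simpleCoroot b i : L)), WeylModule.gen (Z.union Z')⁆ =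
        ((Z.points i).map fun z => z P).sum • WeylModule.gen (Z.union Z') := by
    rw [TensorProduct.smul_tmul', hV.highest.coroot_lie, smul_eq_mul,
      LambdaMultiset.points_union, sum_map_add_mul hst hsZ htZ']
  have hcs (i : b.support) (P : A) :
      ⁅s • (P ⊗ₜ[ℂ] (simpleCoroot b i : L)), WeylModule.gen (Z.union Z')⁆ =
        ((Z'.points i).map fun z => z P).sum • WeylModule.gen (Z.union Z') := by
    rw [TensorProduct.smul_tmul', hV.highest.coroot_lie, smul_eq_mul,
      LambdaMultiset.points_union, add_comm (Z.points i),
      sum_map_add_mul ((add_comm t s).trans hst) htZ' hsZ]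
  have hI : weylIdeal Z ≤ annIdeal (twist t htt) (WeylModule.gen (Z.union Z')) :=
    weylIdeal_le_annIdeal_of_add hV.integrable hcomm hadd (hnt t) hct (hnt s) hcs
  have hJ : weylIdeal Z' ≤ annIdeal (twist s hss) (WeylModule.gen (Z.union Z')) :=
    weylIdeal_le_annIdeal_of_add hV.integrable (fun x y u => (hcomm y x u).symm)
      (fun x u => (add_comm _ _).trans (hadd x u)) (hnt s) hcs (hnt t) hct
  obtain ⟨k, hk⟩ := exists_hom_tensorProduct hcomm hadd hI hJ
  let g := CyclicModule.hom (WeylModule.gen Z ⊗ₜ[ℂ] WeylModule.gen Z') hle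
  have hg : g (WeylModule.gen (Z.union Z')) = _ := CyclicModule.hom_gen _ hle
  -- Each composite fixes a generator, and a homomorphism is determined by its value there.
  have hkg : k.comp g = LieModuleHom.id :=
    hom_eq_of_lieSpan_eq_top hV.generated (by rw [LieModuleHom.comp_apply, hg, hk]; rfl)
  have hgk : g.comp k = LieModuleHom.id :=
    hom_eq_of_lieSpan_eq_top hgen (by rw [LieModuleHom.comp_apply, hk, hg]; rfl)
  exact ⟨{ g with
    invFun := k
    left_inv := fun u => LieModuleHom.congr_fun hkg u
    right_inv := fun u => LieModuleHom.congr_fun hgk u }⟩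

end Main

end LocalWeyl

end

theorem mainTheorem2 {L : Type*} [LieRing L] [LieAlgebra ℂ L] [FiniteDimensional ℂ L]
    [LieAlgebra.IsSemisimple ℂ L] {H : LieSubalgebra ℂ L} [H.IsCartanSubalgebra]
    (b : (LieAlgebra.IsKilling.rootSystem H).Base)
    (A : Type*) [CommRing A] [Algebra ℂ A]
    (lam lam' : Module.Dual ℂ H)
    (Z : LocalWeyl.LambdaMultiset b A lam) (Z' : LocalWeyl.LambdaMultiset b A lam')
    (hZ : ∀ i i', ∀ z ∈ Z.points i, ∀ z' ∈ Z'.points i', z ≠ z') :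
    LocalWeyl.IsLocalWeylModule.{w} Z (LocalWeyl.WeylModule Z) (LocalWeyl.WeylModule.gen Z) ∧
    LocalWeyl.IsLocalWeylModule.{w} Z' (LocalWeyl.WeylModule Z') (LocalWeyl.WeylModule.gen Z') ∧
    LocalWeyl.IsLocalWeylModule.{w} (Z.union Z')
      (LocalWeyl.WeylModule (Z.union Z')) (LocalWeyl.WeylModule.gen (Z.union Z')) ∧
    Nonempty (LocalWeyl.WeylModule (Z.union Z') ≃ₗ⁅ℂ, A ⊗[ℂ] L⁆
      LocalWeyl.WeylModule Z ⊗[ℂ] LocalWeyl.WeylModule Z') :=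
  ⟨LocalWeyl.isLocalWeylModule_weylModule Z, LocalWeyl.isLocalWeylModule_weylModule Z',
    LocalWeyl.isLocalWeylModule_weylModule (Z.union Z'),
    LocalWeyl.nonempty_weylModule_union_equiv Z Z' hZ⟩
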